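/- Let $d\ge 2$ and let $G=\mathrm{SO}^+(d,1)$ be the group of orientation preserving isometries of hyperbolic $d$-space. Let $A=\{a_t\}_{t\in\mathbb R}$ be the Cartan subgroup (the one-parameter group of boosts in a fixed direction, parametrized so that conjugation $u\mapsto a_tua_{-t}$ expands $U$ by the factor $e^t$), $U=\{u\in G: a_{-t}ua_t\to e \text{ as } t\to\infty\}$ the unstable horospherical subgroup, $K\cong\mathrm{SO}(d)$ the maximal compact subgroup of orthogonal matrices in $G$, $M=Z_K(A)$ and $Q=UMA$. Identify $S^{d-1}$ with $Q\backslash G$, on which $G$ acts by right multiplication, and let $\pi_-(g)=Qg$. For $\xi\in Q\backslash G$ and $g,h\in G$ choose $g_\xi\in Kg$ with $\pi_-(g_\xi)=\xi$ and define the Busemann function $b_\xi(g,h)\in\mathbb R$ by the $KAU$-decomposition $hg_\xi^{-1}=k\,a_{b_\xi(g,h)}\,u$ with $k\in K$, $u\in U$. For a subgroup $\Gamma<G$ and $\beta\in\mathbb R$, a measure $\nu$ on $S^{d-1}$ is called $\Gamma$-conformal with parameter $\beta$ if for every $\gamma\in\Gamma$ \[ \frac{d\gamma_*\nu}{d\nu}(\xi)=e^{-\beta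 b_\xi(\gamma^{-1},e)}, \] where $\gamma_*\nu$ is the image of $\nu$ under $\xi\mapsto\xi\gamma^{-1}$. A Borel section is a Borel map $s:S^{d-1}\to G$ with $s(\xi)\in K$ and $\pi_-(s(\xi))=\xi$ for all $\xi$; it gives coordinates $(u,m,a_t,\xi)\mapsto u\,m\,a_t\,s(\xi)$ from $U\times M\times A\times S^{d-1}$ to $G$. Fix Haar measures $du$ on $U$ and $dm$ on $M$, and let $dt$ be Lebesgue measure. Let $\Gamma<G$ be a discrete subgroup and let $\mu$ be a $U$-invariant and $U$-ergodic Radon (locally finite Borel) measure on $G/\Gamma$ which is $MA$-quasi-invariant, that is, $(ma_t)_*\mu$ and $\mu$ are mutually absolutely continuous for all $m\in M$ and $t\in\mathbb R$. Then Borel sections exist, and there are $\beta\in\mathbb R$, a finite $\Gamma$-conformal measure $\nu$ with parameter $\beta$ on $S^{d-1}$, and a measure $\tilde\mu$ on $G$ such that: (i) $\mu$ is induced by $\tilde\mu$, i.e. $\int_G f\,d\tilde\mu=\int_{G/\Gamma}\sum_{g\in x}f(g)\,d\mu(x)$ for every Borel $f:G\to[0,\infty]$, where $x\in G/\Gamma$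 is viewed as a coset in $G$; (ii) in the $U\times M\times A\times S^{d-1}$ coordinates given by any Borel section, \[ d\tilde\mu=e^{\beta t}\,d\nu\,dm\,dt\,du . \] -/

import Mathlib

open MeasureTheory Filter Topology

noncomputable section

namespace HoroMeasure

/-- Index set of the coordinates of `ℝ^(d+1)`, for `d ≥ 1`: the `d - 1` space-like coordinates
`Sum.inl i`, one more space-like coordinate `Sum.inr 0` (the direction of the geodesic flow), and
the time-like coordinate `Sum.inr 1`. -/
abbrev Idx (d : ℕ) : Type := Fin (d - 1) ⊕ Fin 2

/-- The Lorentz form of signature `(d, 1)`. -/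
def lorentz (d : ℕ) : Matrix (Idx d) (Idx d) ℝ :=
  Matrix.diagonal (Sum.elim (fun _ => 1) ![1, -1])

lemma lorentz_mul_self (d : ℕ) : lorentz d * lorentz d = 1 := by
  unfold lorentz
  rw [Matrix.diagonal_mul_diagonal, ← Matrix.diagonal_one]
  congr 1
  funext i
  rcases i with i | i
  · simp
  · fin_cases i <;> simp

lemma lorentz_flip {d : ℕ} {g : Matrix (Idx d) (Idx d) ℝ}
    (h : g.transpose * lorentz d * g = lorentz d) :
    g * lorentz d * g.transpose = lorentz d := by
  have h1 : (lorentz d * g.transpose * lorentz d) * g = 1 := by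
    rw [← lorentz_mul_self d]
    nth_rewrite 4 [← h]
    simp only [Matrix.mul_assoc]
  have h2 : g * (lorentz d * g.transpose * lorentz d) = 1 := mul_eq_one_comm.mp h1
  calc g * lorentz d * g.transpose
      = g * (lorentz d * g.transpose * lorentz d) * lorentz d := by
        simp only [Matrix.mul_assoc, lorentz_mul_self, Matrix.mul_one]
    _ = lorentz d := by rw [h2, Matrix.one_mul]

lemma time_col {d : ℕ} {g : Matrix (Idx d) (Idx d) ℝ}
    (h : g.transpose * lorentz d * g = lorentz d) :
    ∑ i, g (Sum.inl i) (Sum.inr 1) ^ 2 + g (Sum.inr 0) (Sum.inr 1) ^ 2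
      = g (Sum.inr 1) (Sum.inr 1) ^ 2 - 1 := by
  have h1 := congrFun (congrFun h (Sum.inr 1)) (Sum.inr 1)
  rw [Matrix.mul_apply] at h1
  simp [lorentz, Matrix.mul_diagonal, Fintype.sum_sum_type] at h1
  have h2 : ∑ i, g (Sum.inl i) (Sum.inr 1) ^ 2
      = ∑ i, g (Sum.inl i) (Sum.inr 1) * g (Sum.inl i) (Sum.inr 1) :=
    Finset.sum_congr rfl fun i _ => by ring
  rw [h2]
  nlinarith

lemma time_mul_pos {d : ℕ} {g h : Matrix (Idx d) (Idx d) ℝ}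
    (hg : g.transpose * lorentz d * g = lorentz d) (hg0 : 0 < g (Sum.inr 1) (Sum.inr 1))
    (hh : h.transpose * lorentz d * h = lorentz d) (hh0 : 0 < h (Sum.inr 1) (Sum.inr 1)) :
    0 < (g * h) (Sum.inr 1) (Sum.inr 1) := by
  have hg' : (g.transpose).transpose * lorentz d * g.transpose = lorentz d := by
    rw [Matrix.transpose_transpose]; exact lorentz_flip hg
  have e1 := time_col hg'
  have e2 := time_col hh
  simp only [Matrix.transpose_apply] at e1
  have cs := Finset.sum_mul_sq_le_sq_mul_sq Finset.univ
    (fun i : Fin (d - 1) ⊕ Unit => Sum.elim (fun i => g (Sum.inr 1) (Sum.inl i))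
      (fun _ => g (Sum.inr 1) (Sum.inr 0)) i)
    (fun i : Fin (d - 1) ⊕ Unit => Sum.elim (fun i => h (Sum.inl i) (Sum.inr 1))
      (fun _ => h (Sum.inr 0) (Sum.inr 1)) i)
  simp only [Fintype.sum_sum_type, Sum.elim_inl, Sum.elim_inr, Finset.univ_unique,
    Finset.sum_singleton] at cs
  rw [e1, e2] at cs
  rw [Matrix.mul_apply, Fintype.sum_sum_type, Fin.sum_univ_two]
  set x := g (Sum.inr 1) (Sum.inr 1)
  set y := h (Sum.inr 1) (Sum.inr 1)
  set w := ∑ i, g (Sum.inr 1) (Sum.inl i) * h (Sum.inl i) (Sum.inr 1)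
    + g (Sum.inr 1) (Sum.inr 0) * h (Sum.inr 0) (Sum.inr 1) with hw
  have hx1 : 0 ≤ x ^ 2 - 1 := by rw [← e1]; positivity
  have hy1 : 0 ≤ y ^ 2 - 1 := by rw [← e2]; positivity
  have hxy : w ^ 2 < (x * y) ^ 2 := by nlinarith
  have := abs_lt_of_sq_lt_sq hxy (by positivity)
  have := (abs_lt.mp this).1
  linarith

/-- `SO⁺(d,1)`: real matrices of determinant one which preserve the Lorentz form and the
direction of time. -/
def SOplus (d : ℕ) : Subgroup (Matrix.SpecialLinearGroup (Idx d) ℝ) where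
  carrier := {g | (g : Matrix (Idx d) (Idx d) ℝ).transpose * lorentz d * g = lorentz d ∧
    0 < (g : Matrix (Idx d) (Idx d) ℝ) (Sum.inr 1) (Sum.inr 1)}
  one_mem' := by simp
  mul_mem' := by
    rintro a b ⟨ha, ha0⟩ ⟨hb, hb0⟩
    refine ⟨?_, ?_⟩
    · rw [Matrix.SpecialLinearGroup.coe_mul, Matrix.transpose_mul]
      calc _ = (b : Matrix (Idx d) (Idx d) ℝ).transpose *
            ((a : Matrix (Idx d) (Idx d) ℝ).transpose * lorentz d * a) * b := by
            simp only [Matrix.mul_assoc]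
        _ = _ := by rw [ha, hb]
    · rw [Matrix.SpecialLinearGroup.coe_mul]
      exact time_mul_pos ha ha0 hb hb0
  inv_mem' := by
    rintro a ⟨ha, ha0⟩
    have h1 : (lorentz d * (a : Matrix (Idx d) (Idx d) ℝ).transpose * lorentz d) * a = 1 := by
      rw [← lorentz_mul_self d]
      nth_rewrite 4 [← ha]
      simp only [Matrix.mul_assoc]
    have h2 : ((a⁻¹ : Matrix.SpecialLinearGroup (Idx d) ℝ) : Matrix (Idx d) (Idx d) ℝ)
        = lorentz d * (a : Matrix (Idx d) (Idx d) ℝ).transpose * lorentz d := by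
      have h3 : (a : Matrix (Idx d) (Idx d) ℝ) *
          ((a⁻¹ : Matrix.SpecialLinearGroup (Idx d) ℝ) : Matrix (Idx d) (Idx d) ℝ) = 1 := by
        rw [← Matrix.SpecialLinearGroup.coe_mul, mul_inv_cancel,
          Matrix.SpecialLinearGroup.coe_one]
      exact (left_inv_eq_right_inv h1 h3).symm
    refine ⟨?_, ?_⟩
    · rw [h2]
      have h4 := lorentz_flip ha
      have h5 : (lorentz d).transpose = lorentz d := by simp [lorentz]
      simp only [Matrix.transpose_mul, Matrix.transpose_transpose, h5]
      calc _ = lorentz d * ((a : Matrix (Idx d) (Idx d) ℝ) * (lorentz d * (lorentz d * lorentz d)) *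
            (a : Matrix (Idx d) (Idx d) ℝ).transpose) * lorentz d := by
            simp only [Matrix.mul_assoc]
        _ = _ := by rw [lorentz_mul_self, Matrix.mul_one, h4, lorentz_mul_self, Matrix.one_mul]
    · rw [h2]
      simpa [lorentz, Matrix.diagonal_mul, Matrix.mul_diagonal] using ha0

/-- `G = SO⁺(d,1)` as a topological group (with the topology of matrix entries). -/
abbrev G (d : ℕ) : Type := ↥(SOplus d)

instance (d : ℕ) : MeasurableSpace (G d) := borel (G d)

instance (d : ℕ) : BorelSpace (G d) := ⟨rfl⟩

/-- The underlying matrix of an element of `G`. -/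
def mat {d : ℕ} (g : G d) : Matrix (Idx d) (Idx d) ℝ :=
  ((g : Matrix.SpecialLinearGroup (Idx d) ℝ) : Matrix (Idx d) (Idx d) ℝ)

/-- The matrix of the boost `a_t`. -/
def boost (d : ℕ) (t : ℝ) : Matrix (Idx d) (Idx d) ℝ :=
  Matrix.fromBlocks 1 0 0 !![Real.cosh t, Real.sinh t; Real.sinh t, Real.cosh t]

lemma lorentz_eq (d : ℕ) : lorentz d = Matrix.fromBlocks 1 0 0 !![1, 0; 0, -1] := by
  ext i j
  rcases i with i | i <;> rcases j with j | j
  · simp [lorentz, Matrix.diagonal_apply, Matrix.one_apply]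
  · simp [lorentz]
  · simp [lorentz]
  · fin_cases i <;> fin_cases j <;> simp [lorentz]

lemma boost_det (d : ℕ) (t : ℝ) : (boost d t).det = 1 := by
  unfold boost
  rw [Matrix.det_fromBlocks_zero₂₁, Matrix.det_one, one_mul, Matrix.det_fin_two_of]
  nlinarith [Real.cosh_sq t]

lemma boost_add (d : ℕ) (s t : ℝ) : boost d (s + t) = boost d s * boost d t := by
  unfold boost
  rw [Matrix.fromBlocks_multiply]
  congr 1
  · simp
  · simp
  · simp
  · ext i j
    fin_cases i <;> fin_cases j <;> simp [Real.cosh_add, Real.sinh_add] <;> ring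

lemma boost_lorentz (d : ℕ) (t : ℝ) :
    (boost d t).transpose * lorentz d * boost d t = lorentz d := by
  rw [lorentz_eq]
  unfold boost
  rw [Matrix.fromBlocks_transpose, Matrix.fromBlocks_multiply, Matrix.fromBlocks_multiply]
  congr 1
  · simp
  · simp
  · simp
  · ext i j
    fin_cases i <;> fin_cases j <;> simp [Matrix.mul_apply, Fin.sum_univ_two] <;>
      nlinarith [Real.cosh_sq t]

/-- The one-parameter group `t ↦ a_t`, written as an element of `G`. -/
def a (d : ℕ) (t : ℝ) : G d :=
  ⟨⟨boost d t, boost_det d t⟩, boost_lorentz d t, by simpa [boost] using Real.cosh_pos t⟩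

lemma a_add (d : ℕ) (s t : ℝ) : a d (s + t) = a d s * a d t :=
  Subtype.ext (Subtype.ext (boost_add d s t))

lemma a_zero (d : ℕ) : a d 0 = 1 := by
  have h := a_add d 0 0
  rw [add_zero] at h
  exact (left_eq_mul.mp h)

lemma a_neg (d : ℕ) (t : ℝ) : a d (-t) = (a d t)⁻¹ := by
  rw [eq_inv_iff_mul_eq_one, ← a_add, neg_add_cancel, a_zero]

/-- The Cartan subgroup `A = {a_t}`. -/
def A (d : ℕ) : Subgroup (G d) where
  carrier := Set.range (a d)
  one_mem' := ⟨0, a_zero d⟩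
  mul_mem' := by
    rintro _ _ ⟨s, rfl⟩ ⟨t, rfl⟩
    exact ⟨s + t, a_add d s t⟩
  inv_mem' := by
    rintro _ ⟨t, rfl⟩
    exact ⟨-t, a_neg d t⟩

/-- The unstable horospherical subgroup `U = {u : a_{-t} u a_t → e as t → ∞}`. -/
def U (d : ℕ) : Subgroup (G d) where
  carrier := {u | Tendsto (fun t : ℝ => a d (-t) * u * a d t) atTop (𝓝 1)}
  one_mem' := by simp [a_neg]
  mul_mem' := by
    intro u v hu hv
    have h := Tendsto.mul hu hv
    rw [mul_one] at h
    refine h.congr fun t => ?_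
    rw [a_neg]
    group
  inv_mem' := by
    intro u hu
    have h := Tendsto.inv hu
    rw [inv_one] at h
    refine h.congr fun t => ?_
    rw [a_neg]
    group

/-- The maximal compact subgroup `K ≅ SO(d)`: the orthogonal matrices in `G`. -/
def K (d : ℕ) : Subgroup (G d) where
  carrier := {g | mat g ∈ Matrix.orthogonalGroup (Idx d) ℝ}
  one_mem' := one_mem (Matrix.orthogonalGroup (Idx d) ℝ)
  mul_mem' := fun hg hh => (Matrix.orthogonalGroup (Idx d) ℝ).mul_mem hg hh
  inv_mem' := by
    intro g hg
    have h1 : mat g * mat g⁻¹ = 1 := by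
      have : mat (g * g⁻¹) = 1 := by rw [mul_inv_cancel]; rfl
      exact this
    have h2 : star (mat g) * mat g = 1 := (Unitary.mem_iff.mp hg).1
    have h3 : mat g⁻¹ = star (mat g) := (left_inv_eq_right_inv h2 h1).symm
    change mat g⁻¹ ∈ Matrix.orthogonalGroup (Idx d) ℝ
    rw [h3]
    exact Unitary.star_mem hg

/-- `M = Z_K(A)`, the centralizer of `A` in `K`. -/
def M (d : ℕ) : Subgroup (G d) := K d ⊓ Subgroup.centralizer (A d : Set (G d))

/-- The minimal parabolic subgroup `Q = UMA` (the subgroup generated by `U`, `M` and `A`, which is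
the product set because `MA` normalizes `U`). -/
def Q (d : ℕ) : Subgroup (G d) := U d ⊔ M d ⊔ A d

/-- The boundary sphere `S^{d-1} ≅ Q \ G`, with the quotient topology and its Borel structure
(which is the quotient of the Borel structure of `G`). -/
abbrev Bdry (d : ℕ) : Type := Quotient (QuotientGroup.rightRel (Q d))

/-- The projection `π₋ : G → Q \ G`, `g ↦ Qg`. -/
def proj {d : ℕ} (g : G d) : Bdry d := Quotient.mk _ g

/-- The right action of `G` on `Q \ G`: `(Qx) g = Q(xg)`. -/
def act {d : ℕ} (ξ : Bdry d) (g : G d) : Bdry d :=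
  Quotient.map (fun x => x * g) (by
    intro x y h
    have h' := QuotientGroup.rightRel_apply.mp h
    refine QuotientGroup.rightRel_apply.mpr ?_
    simpa [mul_assoc] using h') ξ

/-- `b` is the `A`-parameter in the `KAU`-decomposition `h g_ξ⁻¹ = k a_b u`, where `g_ξ ∈ Kg`
is such that `π₋(g_ξ) = ξ`. -/
def IsBusemann {d : ℕ} (ξ : Bdry d) (g h : G d) (b : ℝ) : Prop :=
  ∃ k₀ ∈ K d, proj (k₀ * g) = ξ ∧ ∃ k ∈ K d, ∃ u ∈ U d, h * (k₀ * g)⁻¹ = k * a d b * u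

/-- The Busemann function `b_ξ(g,h)`; for `d ≥ 2` it is the unique number with `IsBusemann`. -/
def busemann {d : ℕ} (ξ : Bdry d) (g h : G d) : ℝ :=
  Classical.epsilon (IsBusemann ξ g h)

/-- `ν` is `Γ`-conformal with parameter `β`: `d(γ_*ν)/dν (ξ) = exp(-β b_ξ(γ⁻¹, e))` for every
`γ ∈ Γ`, where `γ_*ν` is the image of `ν` under `ξ ↦ ξγ⁻¹`. -/
def IsConformal {d : ℕ} (Γ : Subgroup (G d)) (β : ℝ) (ν : Measure (Bdry d)) : Prop :=
  ∀ γ ∈ Γ, ν.map (fun ξ => act ξ γ⁻¹) =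
    ν.withDensity (fun ξ => ENNReal.ofReal (Real.exp (-β * busemann ξ γ⁻¹ 1)))

/-- `μ` is quasi-invariant under `MA`: `(m a_t)_* μ` has the measure class of `μ`. -/
def IsQuasiInvariantMA {d : ℕ} {Γ : Subgroup (G d)} (μ : Measure (G d ⧸ Γ)) : Prop :=
  ∀ m ∈ M d, ∀ t : ℝ, μ.map (fun x => (m * a d t) • x) ≪ μ ∧
    μ ≪ μ.map (fun x => (m * a d t) • x)

/-- `μ` on `G / Γ` is induced by `μt` on `G` (`μt` is the lift of `μ`): integrating over `G` means
summing over the fibre `gΓ` and integrating the sum over `G / Γ`. -/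
def IsLift {d : ℕ} {Γ : Subgroup (G d)} (μ : Measure (G d ⧸ Γ)) (μt : Measure (G d)) : Prop :=
  ∀ f : G d → ENNReal, Measurable f →
    ∫⁻ g, f g ∂μt =
      ∫⁻ x, ∑' g : (QuotientGroup.mk ⁻¹' {x} : Set (G d)), f (g : G d) ∂μ

/-- A Borel choice of an element of `K` above every boundary point. -/
def IsBorelSection {d : ℕ} (s : Bdry d → G d) : Prop :=
  Measurable s ∧ ∀ ξ, s ξ ∈ K d ∧ proj (s ξ) = ξ

/-- The coordinates `(u, m, a_t, ξ) ↦ u m a_t s(ξ)` on `G` that belong to a section `s`. -/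
def coord {d : ℕ} (s : Bdry d → G d) (p : U d × M d × ℝ × Bdry d) : G d :=
  (p.1 : G d) * (p.2.1 : G d) * a d p.2.2.1 * s p.2.2.2

/-- The measure `e^{βt} dν dm dt du` on `U × M × A × S^{d-1}`, where `A` is parametrized by `t`. -/
def coordMeasure {d : ℕ} (du : Measure (U d)) (dm : Measure (M d)) (β : ℝ)
    (ν : Measure (Bdry d)) : Measure (U d × M d × ℝ × Bdry d) :=
  du.prod (dm.prod
    (((volume : Measure ℝ).withDensity fun t => ENNReal.ofReal (Real.exp (β * t))).prod ν))

end HoroMeasure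

end

noncomputable section

namespace HoroMeasure

variable {d : ℕ}

/-! ### The group `G` as a topological group -/

@[elab_as_elim]
lemma idx_cases {p : Idx d → Prop} (space : ∀ i, p (Sum.inl i)) (flow : p (Sum.inr 0))
    (time : p (Sum.inr 1)) (i : Idx d) : p i := by
  rcases i with i | i
  · exact space i
  · fin_cases i
    · exact flow
    · exact time

lemma mat_mul (g h : G d) : mat (g * h) = mat g * mat h := rfl

lemma mat_one : mat (1 : G d) = 1 := rfl

lemma mat_injective : Function.Injective (mat : G d → Matrix (Idx d) (Idx d) ℝ) :=
  Subtype.val_injective.comp Subtype.val_injective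

lemma mat_lorentz (g : G d) : (mat g).transpose * lorentz d * mat g = lorentz d := g.2.1

lemma mat_lorentz_transpose (g : G d) : mat g * lorentz d * (mat g).transpose = lorentz d :=
  lorentz_flip g.2.1

lemma mat_time_pos (g : G d) : 0 < mat g (Sum.inr 1) (Sum.inr 1) := g.2.2

lemma mat_mul_mat_inv (g : G d) : mat g * mat g⁻¹ = 1 := by
  rw [← mat_mul, mul_inv_cancel, mat_one]

lemma mat_inv_mul_mat (g : G d) : mat g⁻¹ * mat g = 1 := by
  rw [← mat_mul, inv_mul_cancel, mat_one]

lemma continuous_mat : Continuous (mat : G d → Matrix (Idx d) (Idx d) ℝ) :=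
  continuous_subtype_val.comp continuous_subtype_val

lemma continuous_mat_apply (i j : Idx d) : Continuous fun g : G d => mat g i j :=
  continuous_mat.matrix_elem i j

lemma range_mat : Set.range (mat : G d → Matrix (Idx d) (Idx d) ℝ) =
    {g | g.det = 1 ∧ g.transpose * lorentz d * g = lorentz d ∧
      1 ≤ g (Sum.inr 1) (Sum.inr 1)} := by
  ext g
  constructor
  · rintro ⟨g, rfl⟩
    refine ⟨g.1.2, g.2.1, ?_⟩
    have h := time_col g.2.1
    have h0 := mat_time_pos g
    have h1 : 0 ≤ mat g (Sum.inr 1) (Sum.inr 1) ^ 2 - 1 := by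
      rw [mat, ← h]; positivity
    nlinarith
  · rintro ⟨h1, h2, h3⟩
    exact ⟨⟨⟨g, h1⟩, h2, lt_of_lt_of_le one_pos h3⟩, rfl⟩

lemma isClosedEmbedding_mat : IsClosedEmbedding (mat : G d → Matrix (Idx d) (Idx d) ℝ) := by
  refine ⟨IsEmbedding.subtypeVal.comp IsEmbedding.subtypeVal, ?_⟩
  rw [range_mat]
  have h1 : IsClosed {g : Matrix (Idx d) (Idx d) ℝ | g.det = 1} :=
    isClosed_eq continuous_id.matrix_det continuous_const
  have h2 : IsClosed {g : Matrix (Idx d) (Idx d) ℝ | g.transpose * lorentz d * g = lorentz d} :=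
    isClosed_eq ((continuous_id.matrix_transpose.matrix_mul continuous_const).matrix_mul
      continuous_id) continuous_const
  have h3 : IsClosed {g : Matrix (Idx d) (Idx d) ℝ | 1 ≤ g (Sum.inr 1) (Sum.inr 1)} :=
    isClosed_le continuous_const (continuous_id.matrix_elem _ _)
  exact h1.inter (h2.inter h3)

instance : T2Space (G d) := isClosedEmbedding_mat.isEmbedding.t2Space

instance : SecondCountableTopology (G d) :=
  haveI : SecondCountableTopology (Matrix (Idx d) (Idx d) ℝ) :=
    inferInstanceAs (SecondCountableTopology (Idx d → Idx d → ℝ))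
  isClosedEmbedding_mat.isEmbedding.secondCountableTopology

instance : LocallyCompactSpace (G d) :=
  haveI : LocallyCompactSpace (Matrix (Idx d) (Idx d) ℝ) :=
    inferInstanceAs (LocallyCompactSpace (Idx d → Idx d → ℝ))
  isClosedEmbedding_mat.locallyCompactSpace

lemma continuous_of_mat {X : Type*} [TopologicalSpace X] {f : X → G d}
    (h : ∀ i j, Continuous fun x => mat (f x) i j) : Continuous f :=
  isClosedEmbedding_mat.isInducing.continuous_iff.mpr (continuous_matrix h)

lemma mat_a (t : ℝ) : mat (a d t) = boost d t := rfl

lemma continuous_a : Continuous (a d) := by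
  refine continuous_of_mat fun i j => ?_
  simp only [mat_a, boost]
  rcases i with i | i <;> rcases j with j | j
  · simpa using continuous_const
  · simpa using continuous_const
  · simpa using continuous_const
  · fin_cases i <;> fin_cases j <;>
      simp [Real.continuous_cosh, Real.continuous_sinh]

/-! ### The light-like covector fixed by `U` -/

/-- The light-like covector `e₀ - e₁` (in the last two coordinates). -/
def lightCov (d : ℕ) : Idx d → ℝ := Sum.elim 0 ![1, -1]

/-- The image of the light-like covector under `g`, acting on the right. -/
def lightRow (g : G d) : Idx d → ℝ := Matrix.vecMul (lightCov d) (mat g)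

lemma lightRow_mul (g h : G d) : lightRow (g * h) = Matrix.vecMul (lightRow g) (mat h) := by
  simp [lightRow, mat_mul, Matrix.vecMul_vecMul]

lemma lightRow_one : lightRow (1 : G d) = lightCov d := by
  simp [lightRow, mat_one]

lemma lightRow_apply (g : G d) (j : Idx d) :
    lightRow g j = mat g (Sum.inr 0) j - mat g (Sum.inr 1) j := by
  simp [lightRow, lightCov, Matrix.vecMul, dotProduct, Fintype.sum_sum_type, sub_eq_add_neg]

lemma lightRow_mul_of_eq {g : G d} {c : ℝ} (hg : lightRow g = c • lightCov d) (h : G d) :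
    lightRow (g * h) = c • lightRow h := by
  rw [lightRow_mul, hg, Matrix.smul_vecMul]; rfl

lemma lightRow_inv_of_eq {g : G d} {c : ℝ} (hc : c ≠ 0) (hg : lightRow g = c • lightCov d) :
    lightRow g⁻¹ = c⁻¹ • lightCov d := by
  have h := lightRow_mul_of_eq hg g⁻¹
  rw [mul_inv_cancel, lightRow_one] at h
  rw [h, smul_smul, inv_mul_cancel₀ hc, one_smul]

lemma continuous_lightRow (j : Idx d) : Continuous fun g : G d => lightRow g j := by
  simp only [lightRow_apply]
  exact (continuous_mat_apply _ _).sub (continuous_mat_apply _ _)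

lemma lightRow_a (t : ℝ) : lightRow (a d t) = Real.exp (-t) • lightCov d := by
  funext j
  rw [lightRow_apply, mat_a]
  rw [← Real.cosh_sub_sinh]
  induction j using idx_cases <;> simp [boost, lightCov]

lemma lightRow_null (g : G d) :
    ∑ i, lightRow g (Sum.inl i) ^ 2 + lightRow g (Sum.inr 0) ^ 2 =
      lightRow g (Sum.inr 1) ^ 2 := by
  have h := mat_lorentz_transpose g
  have e : ∀ i j, (mat g * lorentz d * (mat g).transpose) i j =
      ∑ k, mat g i (Sum.inl k) * mat g j (Sum.inl k)
      + mat g i (Sum.inr 0) * mat g j (Sum.inr 0) - mat g i (Sum.inr 1) * mat g j (Sum.inr 1) := by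
    intro i j
    rw [Matrix.mul_apply]
    simp [lorentz, Matrix.mul_diagonal, Fintype.sum_sum_type]
    ring
  have h00 := (e (Sum.inr 0) (Sum.inr 0)).symm
  have h01 := (e (Sum.inr 0) (Sum.inr 1)).symm
  have h11 := (e (Sum.inr 1) (Sum.inr 1)).symm
  rw [h] at h00 h01 h11
  simp [lorentz] at h00 h01 h11
  simp only [lightRow_apply]
  have : ∑ i, (mat g (Sum.inr 0) (Sum.inl i) - mat g (Sum.inr 1) (Sum.inl i)) ^ 2 =
      ∑ k, mat g (Sum.inr 0) (Sum.inl k) * mat g (Sum.inr 0) (Sum.inl k)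
      - 2 * ∑ k, mat g (Sum.inr 0) (Sum.inl k) * mat g (Sum.inr 1) (Sum.inl k)
      + ∑ k, mat g (Sum.inr 1) (Sum.inl k) * mat g (Sum.inr 1) (Sum.inl k) := by
    rw [Finset.mul_sum, ← Finset.sum_sub_distrib, ← Finset.sum_add_distrib]
    exact Finset.sum_congr rfl fun i _ => by ring
  rw [this]
  linarith

lemma lightRow_time_neg (g : G d) : lightRow g (Sum.inr 1) < 0 := by
  have h := time_col g.2.1
  have h0 := mat_time_pos g
  change ∑ i, mat g (Sum.inl i) (Sum.inr 1) ^ 2 + mat g (Sum.inr 0) (Sum.inr 1) ^ 2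
      = mat g (Sum.inr 1) (Sum.inr 1) ^ 2 - 1 at h
  rw [lightRow_apply]
  have h1 : 0 ≤ ∑ i, mat g (Sum.inl i) (Sum.inr 1) ^ 2 := by positivity
  have h2 : mat g (Sum.inr 0) (Sum.inr 1) ^ 2 < mat g (Sum.inr 1) (Sum.inr 1) ^ 2 := by linarith
  have := (abs_lt.mp (abs_lt_of_sq_lt_sq h2 h0.le)).2
  linarith

/-- The height of `g`: the `A`-parameter of its `UAK`-decomposition. -/
def height (g : G d) : ℝ := -Real.log (-lightRow g (Sum.inr 1))

lemma lightRow_time (g : G d) : lightRow g (Sum.inr 1) = -Real.exp (-height g) := by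
  rw [height, neg_neg, Real.exp_log (neg_pos.mpr (lightRow_time_neg g)), neg_neg]

lemma continuous_height : Continuous (height : G d → ℝ) :=
  ((continuous_lightRow _).neg.log fun g => (neg_pos.mpr (lightRow_time_neg g)).ne').neg

lemma height_mul_of_eq {g : G d} {t : ℝ} (hg : lightRow g = Real.exp (-t) • lightCov d) (h : G d) :
    height (g * h) = t + height h := by
  have e : lightRow (g * h) (Sum.inr 1) = Real.exp (-t) * lightRow h (Sum.inr 1) := by
    rw [lightRow_mul_of_eq hg]; rfl
  rw [lightRow_time, lightRow_time, mul_neg, ← Real.exp_add, neg_inj, Real.exp_eq_exp] at e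
  linarith

/-! ### The maximal compact subgroup -/

lemma mem_K_iff_mat (g : G d) : g ∈ K d ↔ (mat g).transpose * mat g = 1 := by
  change mat g ∈ Matrix.orthogonalGroup (Idx d) ℝ ↔ _
  rw [Matrix.mem_orthogonalGroup_iff']

lemma mat_inv_of_mem_K {g : G d} (hg : g ∈ K d) : mat g⁻¹ = (mat g).transpose :=
  (left_inv_eq_right_inv ((mem_K_iff_mat g).mp hg) (mat_mul_mat_inv g)).symm

lemma time_col_of_mem_K {g : G d} (hg : g ∈ K d) (i : Idx d) :
    mat g i (Sum.inr 1) = (1 : Matrix (Idx d) (Idx d) ℝ) i (Sum.inr 1) := by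
  have h := time_col g.2.1
  have h0 := mat_time_pos g
  change ∑ i, mat g (Sum.inl i) (Sum.inr 1) ^ 2 + mat g (Sum.inr 0) (Sum.inr 1) ^ 2
      = mat g (Sum.inr 1) (Sum.inr 1) ^ 2 - 1 at h
  have h1 := congrFun (congrFun ((mem_K_iff_mat g).mp hg) (Sum.inr 1)) (Sum.inr 1)
  rw [Matrix.mul_apply] at h1
  simp only [Matrix.transpose_apply, Fintype.sum_sum_type, Fin.sum_univ_two, Matrix.one_apply_eq,
    ← sq] at h1
  have hT : mat g (Sum.inr 1) (Sum.inr 1) = 1 := by nlinarith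
  have hs : 0 ≤ ∑ i, mat g (Sum.inl i) (Sum.inr 1) ^ 2 := by positivity
  rw [hT] at h
  have hO : mat g (Sum.inr 0) (Sum.inr 1) = 0 := by nlinarith
  have hS : ∑ i, mat g (Sum.inl i) (Sum.inr 1) ^ 2 = 0 := by nlinarith
  rw [Finset.sum_eq_zero_iff_of_nonneg fun i _ => by positivity] at hS
  induction i using idx_cases with
  | space i => simpa using hS i (Finset.mem_univ i)
  | flow => simpa using hO
  | time => simpa using hT

lemma time_row_of_mem_K {g : G d} (hg : g ∈ K d) (j : Idx d) :
    mat g (Sum.inr 1) j = (1 : Matrix (Idx d) (Idx d) ℝ) (Sum.inr 1) j := by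
  have h := time_col_of_mem_K ((K d).inv_mem hg) j
  rw [mat_inv_of_mem_K hg, Matrix.transpose_apply] at h
  rw [h, Matrix.one_apply, Matrix.one_apply]
  simp only [eq_comm]

lemma mem_K_of_time_col {g : G d}
    (hg : ∀ i, mat g i (Sum.inr 1) = (1 : Matrix (Idx d) (Idx d) ℝ) i (Sum.inr 1)) : g ∈ K d := by
  have e : ∀ i j, ((mat g).transpose * lorentz d * mat g) i j =
      ((mat g).transpose * mat g) i j - 2 * (mat g (Sum.inr 1) i * mat g (Sum.inr 1) j) := by
    intro i j
    rw [Matrix.mul_apply, Matrix.mul_apply]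
    simp [lorentz, Matrix.mul_diagonal, Fintype.sum_sum_type]
    ring
  have hrow : ∀ j, mat g (Sum.inr 1) j = (1 : Matrix (Idx d) (Idx d) ℝ) (Sum.inr 1) j := by
    intro j
    have h1 := e (Sum.inr 1) j
    rw [mat_lorentz, Matrix.mul_apply] at h1
    simp only [Matrix.transpose_apply, hg] at h1
    simp [Fintype.sum_sum_type, lorentz] at h1
    induction j using idx_cases <;> simp at h1 ⊢ <;> linarith
  rw [mem_K_iff_mat]
  ext i j
  have h1 := e i j
  rw [mat_lorentz, hrow, hrow] at h1
  have h2 : ((mat g).transpose * mat g) i j = lorentz d i j +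
    2 * ((1 : Matrix (Idx d) (Idx d) ℝ) (Sum.inr 1) i *
      (1 : Matrix (Idx d) (Idx d) ℝ) (Sum.inr 1) j) := by linarith
  rw [h2]
  induction i using idx_cases <;> induction j using idx_cases <;>
    simp [lorentz, Matrix.diagonal_apply, Matrix.one_apply]
  norm_num

lemma lightRow_time_of_mem_K {g : G d} (hg : g ∈ K d) : lightRow g (Sum.inr 1) = -1 := by
  rw [lightRow_apply, time_col_of_mem_K hg, time_col_of_mem_K hg]
  simp

lemma height_of_mem_K {g : G d} (hg : g ∈ K d) : height g = 0 := by
  simp [height, lightRow_time_of_mem_K hg]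

lemma isCompact_K : IsCompact (K d : Set (G d)) := by
  have hK : (K d : Set (G d)) = mat ⁻¹' {g | g.transpose * g = 1} := by
    ext g; exact mem_K_iff_mat g
  rw [hK]
  refine isClosedEmbedding_mat.isCompact_preimage ?_
  refine IsCompact.of_isClosed_subset
    (isCompact_univ_pi fun _ : Idx d => isCompact_univ_pi fun _ : Idx d =>
      (isCompact_Icc : IsCompact (Set.Icc (-1 : ℝ) 1))) ?_ ?_
  · exact isClosed_eq (continuous_id.matrix_transpose.matrix_mul continuous_id) continuous_const
  · intro g hg i _ j _
    have h := congrFun (congrFun hg j) j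
    rw [Matrix.mul_apply, Matrix.one_apply_eq] at h
    have h1 : g i j ^ 2 ≤ 1 := by
      rw [← h]
      simp only [Matrix.transpose_apply, ← sq]
      exact Finset.single_le_sum (f := fun k => g k j ^ 2) (fun _ _ => sq_nonneg _)
        (Finset.mem_univ i)
    exact abs_le.mp ((sq_le_one_iff_abs_le_one _).mp h1)

/-! ### Unipotent elements and the Iwasawa decomposition -/

/-- The matrix of the horospherical translation by `x`. -/
def horMat (x : Fin (d - 1) → ℝ) : Matrix (Idx d) (Idx d) ℝ :=
  Matrix.fromBlocks 1 (Matrix.of fun i => ![-x i, x i]) (Matrix.of fun _ j => x j)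
    !![1 - (∑ i, x i ^ 2) / 2, (∑ i, x i ^ 2) / 2; -((∑ i, x i ^ 2) / 2), 1 + (∑ i, x i ^ 2) / 2]

lemma horMat_det (x : Fin (d - 1) → ℝ) : (horMat x).det = 1 := by
  rw [horMat, Matrix.det_fromBlocks_one₁₁, Matrix.det_fin_two]
  simp only [Matrix.sub_apply, Matrix.mul_apply, Matrix.of_apply, Matrix.cons_val_zero,
    Matrix.cons_val_one, mul_neg, Finset.sum_neg_distrib, ← sq, Matrix.cons_val',
    Matrix.cons_val_fin_one]
  ring

lemma horMat_add (x y : Fin (d - 1) → ℝ) : horMat (x + y) = horMat x * horMat y := by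
  have hq : ∑ i, (x + y) i ^ 2 = ∑ i, x i ^ 2 + ∑ i, y i ^ 2 + 2 * ∑ i, x i * y i := by
    rw [Finset.mul_sum, ← Finset.sum_add_distrib, ← Finset.sum_add_distrib]
    exact Finset.sum_congr rfl fun i _ => by simp only [Pi.add_apply]; ring
  unfold horMat
  rw [hq, Matrix.fromBlocks_multiply]
  congr 1
  · ext i j
    simp [Matrix.mul_apply, Fin.sum_univ_two]
  · ext i j
    fin_cases j <;> simp [Matrix.mul_apply, Fin.sum_univ_two] <;> ring
  · ext i j
    fin_cases i <;> simp [Matrix.vecHead, Matrix.vecTail] <;> ring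
  · ext i j
    fin_cases i <;> fin_cases j <;> simp [Matrix.mul_apply] <;> ring

lemma horMat_lorentz (x : Fin (d - 1) → ℝ) :
    (horMat x).transpose * lorentz d * horMat x = lorentz d := by
  rw [lorentz_eq]
  unfold horMat
  rw [Matrix.fromBlocks_transpose, Matrix.fromBlocks_multiply, Matrix.fromBlocks_multiply]
  congr 1
  · ext i j
    simp [Matrix.mul_apply, Fin.sum_univ_two]
  · ext i j
    fin_cases j <;> simp [Matrix.mul_apply, Fin.sum_univ_two] <;> ring
  · ext i j
    fin_cases i <;> simp [Matrix.mul_apply, Fin.sum_univ_two] <;> ring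
  · ext i j
    fin_cases i <;> fin_cases j <;>
      simp [Matrix.mul_apply, Fin.sum_univ_two, ← sq] <;> ring

/-- The horospherical translation by `x`. -/
def hor (x : Fin (d - 1) → ℝ) : G d :=
  ⟨⟨horMat x, horMat_det x⟩, horMat_lorentz x, by
    have : 0 ≤ ∑ i, x i ^ 2 := by positivity
    simp only [horMat, Matrix.fromBlocks_apply₂₂, Matrix.of_apply, Matrix.cons_val_one,
      Matrix.cons_val_fin_one, Matrix.cons_val']
    linarith⟩

lemma mat_hor (x : Fin (d - 1) → ℝ) : mat (hor x) = horMat x := rfl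

lemma hor_add (x y : Fin (d - 1) → ℝ) : hor (x + y) = hor x * hor y :=
  mat_injective (horMat_add x y)

lemma hor_zero : hor (0 : Fin (d - 1) → ℝ) = 1 := by
  have h := hor_add (0 : Fin (d - 1) → ℝ) 0
  rw [add_zero] at h
  exact left_eq_mul.mp h

lemma continuous_hor : Continuous (hor : (Fin (d - 1) → ℝ) → G d) := by
  refine continuous_of_mat fun i j => ?_
  simp only [mat_hor, horMat]
  induction i using idx_cases <;> induction j using idx_cases <;> simp <;> fun_prop

lemma lightRow_hor (x : Fin (d - 1) → ℝ) : lightRow (hor x) = lightCov d := by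
  funext j
  rw [lightRow_apply, mat_hor]
  induction j using idx_cases <;> simp [horMat, lightCov]

/-- The horospherical coordinate of `g`: the `U`-part of its `UAK`-decomposition. -/
def horCoord (g : G d) : Fin (d - 1) → ℝ :=
  fun i => mat g (Sum.inl i) (Sum.inr 1) * Real.exp (height g)

lemma continuous_horCoord : Continuous (horCoord : G d → Fin (d - 1) → ℝ) :=
  continuous_pi fun _ => (continuous_mat_apply _ _).mul (Real.continuous_exp.comp continuous_height)

lemma time_col_hor_mul_a (x : Fin (d - 1) → ℝ) (t : ℝ) (i : Fin (d - 1)) :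
    mat (hor x * a d t) (Sum.inl i) (Sum.inr 1) = x i * Real.exp (-t) := by
  have hE := Real.cosh_sub_sinh t
  rw [mat_mul, mat_hor, mat_a, Matrix.mul_apply]
  simp [horMat, boost, Fintype.sum_sum_type]
  rw [← hE]
  ring

lemma lightRow_hor_mul_a (x : Fin (d - 1) → ℝ) (t : ℝ) :
    lightRow (hor x * a d t) = Real.exp (-t) • lightCov d := by
  rw [lightRow_mul, lightRow_hor]
  exact lightRow_a t

/-- A point of the hyperboloid is determined by its space-like coordinates other than the one in
the direction of the flow, and by its height. -/
lemma time_col_eq {g h : G d} (hx : ∀ i, mat g (Sum.inl i) (Sum.inr 1) =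
    mat h (Sum.inl i) (Sum.inr 1)) (ht : height g = height h) (i : Idx d) :
    mat g i (Sum.inr 1) = mat h i (Sum.inr 1) := by
  have eg := time_col g.2.1
  have eh := time_col h.2.1
  change ∑ i, mat g (Sum.inl i) (Sum.inr 1) ^ 2 + mat g (Sum.inr 0) (Sum.inr 1) ^ 2
      = mat g (Sum.inr 1) (Sum.inr 1) ^ 2 - 1 at eg
  change ∑ i, mat h (Sum.inl i) (Sum.inr 1) ^ 2 + mat h (Sum.inr 0) (Sum.inr 1) ^ 2
      = mat h (Sum.inr 1) (Sum.inr 1) ^ 2 - 1 at eh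
  have lg := lightRow_time g
  have lh := lightRow_time h
  rw [ht, ← lh, lightRow_apply, lightRow_apply] at lg
  simp only [hx] at eg
  have hneg := lightRow_time_neg h
  rw [lightRow_apply] at hneg
  have hsum : mat g (Sum.inr 0) (Sum.inr 1) + mat g (Sum.inr 1) (Sum.inr 1) =
      mat h (Sum.inr 0) (Sum.inr 1) + mat h (Sum.inr 1) (Sum.inr 1) := by
    apply mul_left_cancel₀ hneg.ne
    have : (mat h (Sum.inr 0) (Sum.inr 1) - mat h (Sum.inr 1) (Sum.inr 1)) *
      (mat g (Sum.inr 0) (Sum.inr 1) + mat g (Sum.inr 1) (Sum.inr 1)) =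
      (mat g (Sum.inr 0) (Sum.inr 1) - mat g (Sum.inr 1) (Sum.inr 1)) *
      (mat g (Sum.inr 0) (Sum.inr 1) + mat g (Sum.inr 1) (Sum.inr 1)) := by rw [lg]
    rw [this]
    linarith
  induction i using idx_cases with
  | space i => exact hx i
  | flow => linarith
  | time => linarith

lemma inv_mul_mem_K {g h : G d} (e : ∀ i, mat h i (Sum.inr 1) = mat g i (Sum.inr 1)) :
    g⁻¹ * h ∈ K d := by
  refine mem_K_of_time_col fun i => ?_
  rw [mat_mul, Matrix.mul_apply]
  simp only [e]
  rw [← Matrix.mul_apply, mat_inv_mul_mat]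

/-- The `K`-part of the `UAK`-decomposition of `g`. -/
def kPart (g : G d) : G d := (hor (horCoord g) * a d (height g))⁻¹ * g

lemma iwasawa (g : G d) : g = hor (horCoord g) * a d (height g) * kPart g := by
  rw [kPart, mul_inv_cancel_left]

lemma kPart_mem (g : G d) : kPart g ∈ K d := by
  refine inv_mul_mem_K fun i => ?_
  refine time_col_eq (fun i => ?_) ?_ i
  · rw [time_col_hor_mul_a, horCoord, mul_assoc, ← Real.exp_add, add_neg_cancel, Real.exp_zero,
      mul_one]
  · have h := height_mul_of_eq (lightRow_hor_mul_a (horCoord g) (height g)) 1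
    rw [mul_one, height_of_mem_K (one_mem _), add_zero] at h
    exact h.symm

lemma continuous_kPart : Continuous (kPart : G d → G d) :=
  ((continuous_hor.comp continuous_horCoord).mul
    (continuous_a.comp continuous_height)).inv.mul continuous_id

lemma height_hor_mul_a_mul (x : Fin (d - 1) → ℝ) (t : ℝ) (g : G d) :
    height (hor x * a d t * g) = t + height g :=
  height_mul_of_eq (lightRow_hor_mul_a x t) g

lemma time_col_mul_of_mem_K (g : G d) {k : G d} (hk : k ∈ K d) (i : Idx d) :
    mat (g * k) i (Sum.inr 1) = mat g i (Sum.inr 1) := by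
  rw [mat_mul, Matrix.mul_apply]
  simp only [time_col_of_mem_K hk]
  rw [← Matrix.mul_apply, mul_one]

lemma horCoord_hor_mul_a_mul (x : Fin (d - 1) → ℝ) (t : ℝ) {k : G d} (hk : k ∈ K d) :
    horCoord (hor x * a d t * k) = x := by
  funext i
  rw [horCoord, height_hor_mul_a_mul, height_of_mem_K hk, add_zero, time_col_mul_of_mem_K _ hk,
    time_col_hor_mul_a, mul_assoc, ← Real.exp_add, neg_add_cancel, Real.exp_zero, mul_one]

/-! ### The subgroups `U`, `M` and `Q` -/

lemma a_comm (s t : ℝ) : a d s * a d t = a d t * a d s := by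
  rw [← a_add, ← a_add, add_comm]

lemma mem_M_iff {m : G d} : m ∈ M d ↔ m ∈ K d ∧ ∀ t, a d t * m = m * a d t := by
  refine and_congr_right fun _ => ?_
  change m ∈ Subgroup.centralizer (A d : Set (G d)) ↔ _
  rw [Subgroup.mem_centralizer_iff]
  constructor
  · intro h t
    exact h _ ⟨t, rfl⟩
  · rintro h _ ⟨t, rfl⟩
    exact h t

lemma M_le_K : M d ≤ K d := inf_le_left

lemma vecMul_boost (p : Idx d → ℝ) (t : ℝ) : Matrix.vecMul p (boost d t) =
    Sum.elim (fun i => p (Sum.inl i))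
      ![p (Sum.inr 0) * Real.cosh t + p (Sum.inr 1) * Real.sinh t,
        p (Sum.inr 0) * Real.sinh t + p (Sum.inr 1) * Real.cosh t] := by
  funext j
  rw [Matrix.vecMul, dotProduct, Fintype.sum_sum_type, Fin.sum_univ_two]
  induction j using idx_cases <;> simp [boost, Matrix.one_apply]

lemma lightRow_of_mem_M {m : G d} (hm : m ∈ M d) : lightRow m = lightCov d := by
  obtain ⟨hK, hc⟩ := mem_M_iff.mp hm
  have hT := lightRow_time_of_mem_K hK
  have h1 : lightRow (a d 1 * m) = lightRow (m * a d 1) := by rw [hc]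
  rw [lightRow_mul_of_eq (lightRow_a 1), lightRow_mul, mat_a, vecMul_boost] at h1
  have he : Real.exp (-1) < 1 := by simp
  funext j
  induction j using idx_cases with
  | space i =>
    have h2 := congrFun h1 (Sum.inl i)
    simp at h2
    simp only [lightCov, Sum.elim_inl, Pi.zero_apply]
    by_contra h3
    exact he.ne (mul_right_cancel₀ h3 (h2.trans (one_mul _).symm))
  | flow =>
    have h2 := congrFun h1 (Sum.inr 0)
    simp only [Pi.smul_apply, smul_eq_mul, Sum.elim_inr, Matrix.cons_val_zero, hT,
      ← Real.cosh_sub_sinh] at h2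
    have hs : 0 < Real.sinh 1 := Real.sinh_pos_iff.mpr one_pos
    simp only [lightCov, Sum.elim_inr, Matrix.cons_val_zero]
    apply mul_right_cancel₀ hs.ne'
    linarith
  | time => simp [hT, lightCov]

lemma mem_M_of_lightRow {k : G d} (hk : k ∈ K d) (h : lightRow k = lightCov d) : k ∈ M d := by
  have rows : ∀ g : G d, g ∈ K d → lightRow g = lightCov d → ∀ (i : Fin 2) j,
      mat g (Sum.inr i) j = (1 : Matrix (Idx d) (Idx d) ℝ) (Sum.inr i) j := by
    intro g hg hl i j
    have h1 := time_row_of_mem_K hg j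
    fin_cases i
    · have h2 := congrFun hl j
      rw [lightRow_apply, h1] at h2
      change mat g (Sum.inr 0) j = (1 : Matrix (Idx d) (Idx d) ℝ) (Sum.inr 0) j
      rw [sub_eq_iff_eq_add.mp h2]
      induction j using idx_cases <;> simp [lightCov]
    · exact h1
  have hrow := rows k hk h
  have hinv : lightRow k⁻¹ = lightCov d := by
    have := lightRow_inv_of_eq (c := 1) one_ne_zero (by rw [h, one_smul])
    simpa using this
  have hcol : ∀ j (i : Fin 2), mat k j (Sum.inr i) =
      (1 : Matrix (Idx d) (Idx d) ℝ) (Sum.inr i) j := by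
    intro j i
    have := rows k⁻¹ ((K d).inv_mem hk) hinv i j
    rwa [mat_inv_of_mem_K hk, Matrix.transpose_apply] at this
  rw [mem_M_iff]
  refine ⟨hk, fun t => mat_injective ?_⟩
  have hblock : mat k = Matrix.fromBlocks (mat k).toBlocks₁₁ 0 0 1 := by
    ext i j
    rcases i with i | i <;> rcases j with j | j
    · rfl
    · rw [hcol]; simp
    · rw [hrow]; simp
    · rw [hrow]; simp [Matrix.one_apply]
  rw [mat_mul, mat_mul, mat_a, hblock, boost, Matrix.fromBlocks_multiply,
    Matrix.fromBlocks_multiply]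
  simp

lemma exists_of_lightRow_eq_smul {g : G d} {c : ℝ} (h : lightRow g = c • lightCov d) :
    ∃ m ∈ M d, g = hor (horCoord g) * a d (height g) * m := by
  refine ⟨kPart g, mem_M_of_lightRow (kPart_mem g) ?_, iwasawa g⟩
  have h1 := congrArg lightRow (iwasawa g)
  rw [lightRow_mul_of_eq (lightRow_hor_mul_a _ _), h] at h1
  have hT := lightRow_time_of_mem_K (kPart_mem g)
  have h2 := congrFun h1 (Sum.inr 1)
  simp only [Pi.smul_apply, hT, lightCov, Sum.elim_inr, Matrix.cons_val_one,
    Matrix.cons_val_fin_one, smul_eq_mul] at h2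
  have h3 : c = Real.exp (-height g) := by linarith
  rw [h3] at h1
  exact (smul_right_injective _ (Real.exp_pos _).ne' h1).symm

lemma conj_hor (x : Fin (d - 1) → ℝ) (t : ℝ) :
    a d t * hor x * a d (-t) = hor (Real.exp t • x) := by
  apply mat_injective
  rw [mat_mul, mat_mul, mat_a, mat_a, mat_hor, mat_hor, horMat, horMat, boost, boost,
    Matrix.fromBlocks_multiply, Matrix.fromBlocks_multiply]
  have hs : ∑ i, (Real.exp t • x) i ^ 2 = Real.exp t ^ 2 * ∑ i, x i ^ 2 := by
    simp [mul_pow, Finset.mul_sum]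
  have hE := (Real.cosh_add_sinh t).symm
  have hc := Real.cosh_sq t
  rw [hs]
  congr 1
  · simp
  · ext i j
    fin_cases j <;> simp [Matrix.mul_apply, Fin.sum_univ_two] <;> rw [hE] <;> ring
  · ext i j
    fin_cases i <;> simp [Matrix.vecHead, Matrix.vecTail] <;> rw [hE] <;> ring
  · ext i j
    fin_cases i <;> fin_cases j <;> simp <;> rw [hE] <;> ring_nf <;> rw [hc] <;> ring

lemma hor_mem_U (x : Fin (d - 1) → ℝ) : hor x ∈ U d := by
  change Tendsto (fun t : ℝ => a d (-t) * hor x * a d t) atTop (𝓝 1)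
  have h : ∀ t, a d (-t) * hor x * a d t = hor (Real.exp (-t) • x) := by
    intro t
    have := conj_hor x (-t)
    rwa [neg_neg] at this
  simp only [h]
  have h0 : Tendsto (fun t : ℝ => Real.exp (-t) • x) atTop (𝓝 0) := by
    have := (Real.tendsto_exp_neg_atTop_nhds_zero).smul_const x
    rwa [zero_smul] at this
  have h1 := (continuous_hor (d := d)).tendsto 0
  rw [hor_zero] at h1
  exact h1.comp h0

lemma mem_U_iff {u : G d} : u ∈ U d ↔ u = hor (horCoord u) := by
  refine ⟨fun hu => ?_, fun hu => hu ▸ hor_mem_U _⟩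
  have ht : Tendsto (fun t : ℝ => a d (-t) * u * a d t) atTop (𝓝 1) := hu
  have hrow : ∀ t : ℝ, lightRow (a d (-t) * u * a d t) =
      Real.exp t • Matrix.vecMul (lightRow u) (boost d t) := by
    intro t
    rw [mul_assoc, lightRow_mul_of_eq (lightRow_a (-t)), neg_neg, lightRow_mul, mat_a]
  have hlim : ∀ j, Tendsto (fun t : ℝ => Real.exp t * Matrix.vecMul (lightRow u) (boost d t) j)
      atTop (𝓝 (lightCov d j)) := by
    intro j
    have h1 := ((continuous_lightRow j).tendsto 1).comp ht
    rw [lightRow_one] at h1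
    refine h1.congr fun t => ?_
    simp only [Function.comp, hrow]
    rfl
  have vanish : ∀ (f : ℝ → ℝ) (c : ℝ), (∀ᶠ t in atTop, f t = Real.exp t * c) →
      Tendsto f atTop (𝓝 0) → c = 0 := by
    intro f c hf h0
    have h1 : Tendsto (fun t => Real.exp (-t) * f t) atTop (𝓝 (0 * 0)) :=
      Real.tendsto_exp_neg_atTop_nhds_zero.mul h0
    have h2 : Tendsto (fun t => Real.exp (-t) * f t) atTop (𝓝 c) := by
      refine tendsto_const_nhds.congr' ?_
      filter_upwards [hf] with t ht
      rw [ht, ← mul_assoc, ← Real.exp_add, neg_add_cancel, Real.exp_zero, one_mul]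
    rw [mul_zero] at h1
    exact tendsto_nhds_unique h2 h1
  have hx : ∀ i, lightRow u (Sum.inl i) = 0 := by
    intro i
    refine vanish _ _ (Eventually.of_forall fun t => ?_) (hlim (Sum.inl i))
    rw [vecMul_boost]
    rfl
  have hnull := lightRow_null u
  have hneg := lightRow_time_neg u
  simp only [hx, ne_eq, OfNat.ofNat_ne_zero, not_false_eq_true, zero_pow,
    Finset.sum_const_zero, zero_add] at hnull
  have hsum : lightRow u (Sum.inr 0) + lightRow u (Sum.inr 1) = 0 := by
    have hl := (hlim (Sum.inr 0)).add (hlim (Sum.inr 1))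
    simp only [vecMul_boost, lightCov, Sum.elim_inr, Matrix.cons_val_zero, Matrix.cons_val_one,
      Matrix.cons_val_fin_one, add_neg_cancel] at hl
    have h2 : Tendsto (fun t : ℝ => Real.exp t *
        (lightRow u (Sum.inr 0) + lightRow u (Sum.inr 1))) atTop (𝓝 0) := by
      have h3 := Real.tendsto_exp_neg_atTop_nhds_zero.mul hl
      rw [mul_zero] at h3
      refine h3.congr fun t => ?_
      have : Real.exp (-t) * (Real.exp t * (lightRow u (Sum.inr 0) * Real.cosh t +
          lightRow u (Sum.inr 1) * Real.sinh t) + Real.exp t * (lightRow u (Sum.inr 0) *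
          Real.sinh t + lightRow u (Sum.inr 1) * Real.cosh t)) =
          (Real.exp (-t) * Real.exp t) * (Real.cosh t + Real.sinh t) *
            (lightRow u (Sum.inr 0) + lightRow u (Sum.inr 1)) := by ring
      rw [this, ← Real.exp_add, neg_add_cancel, Real.exp_zero, Real.cosh_add_sinh, one_mul]
    exact vanish _ _ (Eventually.of_forall fun _ => rfl) h2
  have hrowu : lightRow u = (-lightRow u (Sum.inr 1)) • lightCov d := by
    funext j
    induction j using idx_cases with
    | space i => simp [hx, lightCov]
    | flow => simp [lightCov]; linarith
    | time => simp [lightCov]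
  obtain ⟨m, hm, hum⟩ := exists_of_lightRow_eq_smul hrowu
  -- the flow conjugation does not change the `MA`-part, so it is trivial
  set v := a d (height u) * m with hv
  have hvU : v ∈ U d := by
    have : v = (hor (horCoord u))⁻¹ * u := by
      rw [eq_inv_mul_iff_mul_eq, hv, ← mul_assoc]; exact hum.symm
    rw [this]
    exact (U d).mul_mem ((U d).inv_mem (hor_mem_U _)) hu
  have hv1 : v = 1 := by
    have h1 : Tendsto (fun t : ℝ => a d (-t) * v * a d t) atTop (𝓝 1) := hvU
    refine tendsto_nhds_unique (tendsto_const_nhds.congr fun t => ?_) h1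
    rw [hv, mul_assoc, mul_assoc, ← (mem_M_iff.mp hm).2 t, ← mul_assoc (a d (height u)),
      a_comm (height u) t, mul_assoc, ← mul_assoc (a d (-t)), ← a_add, neg_add_cancel, a_zero,
      one_mul]
  rw [hv] at hv1
  rw [mul_assoc, hv1, mul_one] at hum
  exact hum

lemma hor_mul_comm (x y : Fin (d - 1) → ℝ) : hor x * hor y = hor y * hor x := by
  rw [← hor_add, ← hor_add, add_comm]

lemma U_mul_comm (u v : U d) : u * v = v * u := by
  apply Subtype.ext
  rw [Subgroup.coe_mul, Subgroup.coe_mul, mem_U_iff.mp u.2, mem_U_iff.mp v.2, hor_mul_comm]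

lemma isClosed_U : IsClosed (U d : Set (G d)) := by
  have h : (U d : Set (G d)) = {u | u = hor (horCoord u)} := by
    ext u; exact mem_U_iff
  rw [h]
  exact isClosed_eq continuous_id (continuous_hor.comp continuous_horCoord)

instance : LocallyCompactSpace (U d) := isClosed_U.isClosedEmbedding_subtypeVal.locallyCompactSpace

lemma isCompact_M : IsCompact (M d : Set (G d)) := by
  refine isCompact_K.of_isClosed_subset ?_ M_le_K
  have h : (M d : Set (G d)) = (K d : Set (G d)) ∩ {m | ∀ t, a d t * m = m * a d t} := by
    ext m; exact mem_M_iff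
  rw [h, Set.ofPred_forall]
  refine isCompact_K.isClosed.inter (isClosed_iInter fun t => isClosed_eq ?_ ?_)
  · exact continuous_const.mul continuous_id
  · exact continuous_id.mul continuous_const

instance : CompactSpace (M d) := isCompact_iff_compactSpace.mp isCompact_M

lemma lightRow_of_mem_U {u : G d} (hu : u ∈ U d) : lightRow u = lightCov d := by
  rw [mem_U_iff.mp hu, lightRow_hor]

/-- The centralizer of the flow, in particular `MA`, normalizes `U`. -/
lemma conj_mem_U {q u : G d} (hq : ∀ t, a d t * q = q * a d t) (hu : u ∈ U d) :
    q * u * q⁻¹ ∈ U d := by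
  have h : Tendsto (fun t : ℝ => a d (-t) * u * a d t) atTop (𝓝 1) := hu
  change Tendsto (fun t : ℝ => a d (-t) * (q * u * q⁻¹) * a d t) atTop (𝓝 1)
  have h1 := (tendsto_const_nhds (x := q)).mul (h.mul (tendsto_const_nhds (x := q⁻¹)))
  rw [one_mul, mul_inv_cancel] at h1
  refine h1.congr fun t => ?_
  have e1 : a d t * q⁻¹ = q⁻¹ * a d t := by
    rw [eq_inv_mul_iff_mul_eq, ← mul_assoc, ← hq, mul_assoc, mul_inv_cancel, mul_one]
  calc q * (a d (-t) * u * a d t * q⁻¹) = (q * a d (-t)) * u * (a d t * q⁻¹) := by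
        simp only [mul_assoc]
    _ = _ := by rw [e1, ← hq]; simp only [mul_assoc]

lemma a_mul_comm_of_MA {m : G d} (hm : m ∈ M d) (r t : ℝ) :
    a d t * (m * a d r) = m * a d r * a d t := by
  rw [← mul_assoc, (mem_M_iff.mp hm).2, mul_assoc, a_comm, mul_assoc]

/-! ### The boundary -/

lemma mem_Q_iff {q : G d} : q ∈ Q d ↔ ∃ c : ℝ, lightRow q = c • lightCov d := by
  constructor
  · intro hq
    let R : Subgroup (G d) :=
      { carrier := {g | ∃ c : ℝ, c ≠ 0 ∧ lightRow g = c • lightCov d}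
        one_mem' := ⟨1, one_ne_zero, by rw [lightRow_one, one_smul]⟩
        mul_mem' := by
          rintro g h ⟨c, hc0, hc⟩ ⟨e, he0, he⟩
          exact ⟨c * e, mul_ne_zero hc0 he0, by rw [lightRow_mul_of_eq hc, he, smul_smul]⟩
        inv_mem' := by
          rintro g ⟨c, hc0, hc⟩
          exact ⟨c⁻¹, inv_ne_zero hc0, lightRow_inv_of_eq hc0 hc⟩ }
    have hR : Q d ≤ R := by
      refine sup_le (sup_le ?_ ?_) ?_
      · intro u hu
        exact ⟨1, one_ne_zero, by rw [lightRow_of_mem_U hu, one_smul]⟩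
      · intro m hm
        exact ⟨1, one_ne_zero, by rw [lightRow_of_mem_M hm, one_smul]⟩
      · rintro _ ⟨t, rfl⟩
        exact ⟨_, (Real.exp_pos _).ne', lightRow_a t⟩
    obtain ⟨c, -, hc⟩ := hR hq
    exact ⟨c, hc⟩
  · rintro ⟨c, hc⟩
    obtain ⟨m, hm, h⟩ := exists_of_lightRow_eq_smul hc
    rw [h]
    refine mul_mem (mul_mem ?_ ?_) ?_
    · exact (le_sup_left.trans le_sup_left : U d ≤ Q d) (hor_mem_U _)
    · exact (le_sup_right : A d ≤ Q d) ⟨_, rfl⟩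
    · exact (le_sup_right.trans le_sup_left : M d ≤ Q d) hm

lemma proj_eq_iff {g h : G d} : proj g = proj h ↔ ∃ c : ℝ, lightRow g = c • lightRow h := by
  have h1 : proj g = proj h ↔ g * h⁻¹ ∈ Q d := by
    rw [eq_comm]
    exact Quotient.eq.trans QuotientGroup.rightRel_apply
  rw [h1, mem_Q_iff]
  refine exists_congr fun c => ⟨fun e => ?_, fun e => ?_⟩
  · rw [← lightRow_mul_of_eq e, inv_mul_cancel_right]
  · rw [lightRow_mul, e, Matrix.smul_vecMul, ← lightRow_mul, mul_inv_cancel, lightRow_one]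

lemma proj_mul_of_lightRow {q : G d} {c : ℝ} (hq : lightRow q = c • lightCov d) (g : G d) :
    proj (q * g) = proj g :=
  proj_eq_iff.mpr ⟨c, lightRow_mul_of_eq hq g⟩

lemma lightRow_umat {u m : G d} (hu : u ∈ U d) (hm : m ∈ M d) (t : ℝ) :
    lightRow (u * m * a d t) = Real.exp (-t) • lightCov d := by
  rw [mul_assoc, lightRow_mul, lightRow_of_mem_U hu]
  change lightRow (m * a d t) = _
  rw [lightRow_mul, lightRow_of_mem_M hm]
  exact lightRow_a t

lemma proj_kPart (g : G d) : proj (kPart g) = proj g := by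
  conv_rhs => rw [iwasawa g]
  exact (proj_mul_of_lightRow (lightRow_hor_mul_a _ _) _).symm

lemma lightRow_eq_of_mem_K {k k' : G d} (hk : k ∈ K d) (hk' : k' ∈ K d) (h : proj k = proj k') :
    lightRow k = lightRow k' := by
  obtain ⟨c, hc⟩ := proj_eq_iff.mp h
  have h1 := congrFun hc (Sum.inr 1)
  rw [Pi.smul_apply, lightRow_time_of_mem_K hk, lightRow_time_of_mem_K hk', smul_eq_mul] at h1
  rw [hc, show c = 1 by linarith, one_smul]

lemma mul_inv_mem_M {k k' : G d} (hk : k ∈ K d) (hk' : k' ∈ K d) (h : proj k = proj k') :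
    k * k'⁻¹ ∈ M d := by
  refine mem_M_of_lightRow ((K d).mul_mem hk ((K d).inv_mem hk')) ?_
  rw [lightRow_mul, lightRow_eq_of_mem_K hk hk' h, ← lightRow_mul, mul_inv_cancel, lightRow_one]

lemma act_proj (g h : G d) : act (proj g) h = proj (g * h) := rfl

lemma measurable_proj : Measurable (proj : G d → Bdry d) := measurable_quotient_mk''

lemma measurable_act (g : G d) : Measurable fun ξ : Bdry d => act ξ g :=
  measurable_from_quotient.mpr (measurable_proj.comp (measurable_mul_const g))

/-! ### A Borel section -/

/-- The opposite horospherical translation by `y`. -/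
def oppHor (y : Fin (d - 1) → ℝ) : G d :=
  ⟨⟨(horMat y).transpose, by rw [Matrix.det_transpose, horMat_det]⟩, by
    change (horMat y).transpose.transpose * lorentz d * (horMat y).transpose = lorentz d
    rw [Matrix.transpose_transpose]
    exact lorentz_flip (horMat_lorentz y), (hor y).2.2⟩

lemma mat_oppHor (y : Fin (d - 1) → ℝ) : mat (oppHor y) = (mat (hor y)).transpose := rfl

lemma continuous_oppHor : Continuous (oppHor : (Fin (d - 1) → ℝ) → G d) :=
  continuous_of_mat fun i j => (continuous_mat_apply j i).comp continuous_hor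

lemma lightRow_oppHor (y : Fin (d - 1) → ℝ) : lightRow (oppHor y) =
    Sum.elim (fun i => -2 * y i) ![1 - ∑ i, y i ^ 2, -1 - ∑ i, y i ^ 2] := by
  funext j
  rw [lightRow_apply, mat_oppHor, Matrix.transpose_apply, Matrix.transpose_apply, mat_hor]
  induction j using idx_cases <;> simp [horMat] <;> ring

/-- The stereographic coordinate of the boundary point `Qg`, away from one point. -/
def stereo (g : G d) : Fin (d - 1) → ℝ :=
  fun i => -lightRow g (Sum.inl i) / (lightRow g (Sum.inr 0) - lightRow g (Sum.inr 1))

lemma measurable_stereo : Measurable (stereo : G d → Fin (d - 1) → ℝ) :=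
  measurable_pi_lambda _ fun _ => (continuous_lightRow _).measurable.neg.div
    ((continuous_lightRow _).measurable.sub (continuous_lightRow _).measurable)

lemma proj_oppHor_stereo {g : G d} (hg : lightRow g (Sum.inr 0) ≠ lightRow g (Sum.inr 1)) :
    proj (oppHor (stereo g)) = proj g := by
  have hne : lightRow g (Sum.inr 0) - lightRow g (Sum.inr 1) ≠ 0 := sub_ne_zero.mpr hg
  have hnull := lightRow_null g
  have hs : ∑ i, stereo g i ^ 2 = (lightRow g (Sum.inr 1) ^ 2 - lightRow g (Sum.inr 0) ^ 2) /
      (lightRow g (Sum.inr 0) - lightRow g (Sum.inr 1)) ^ 2 := by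
    rw [← hnull, add_sub_cancel_right, Finset.sum_div]
    refine Finset.sum_congr rfl fun i _ => ?_
    rw [stereo, div_pow, neg_sq]
  refine proj_eq_iff.mpr ⟨2 / (lightRow g (Sum.inr 0) - lightRow g (Sum.inr 1)), ?_⟩
  rw [lightRow_oppHor, hs]
  funext j
  induction j using idx_cases with
  | space i => simp [stereo]; ring
  | flow => simp; field_simp; ring
  | time => simp; field_simp; ring

lemma proj_eq_of_lightRow_eq {g h : G d} (hg : lightRow g (Sum.inr 0) = lightRow g (Sum.inr 1))
    (hh : lightRow h (Sum.inr 0) = lightRow h (Sum.inr 1)) : proj g = proj h := by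
  have zero : ∀ g : G d, lightRow g (Sum.inr 0) = lightRow g (Sum.inr 1) →
      ∀ i, lightRow g (Sum.inl i) = 0 := by
    intro g hg i
    have hnull := lightRow_null g
    rw [hg, add_eq_right, Finset.sum_eq_zero_iff_of_nonneg fun i _ => by positivity] at hnull
    simpa using hnull i (Finset.mem_univ i)
  refine proj_eq_iff.mpr ⟨lightRow g (Sum.inr 1) / lightRow h (Sum.inr 1), ?_⟩
  have hne := (lightRow_time_neg h).ne
  funext j
  induction j using idx_cases with
  | space i => simp [zero g hg, zero h hh]
  | flow => simp [hg, hh, hne]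
  | time => simp [hne]

open Classical in
theorem exists_isBorelSection : ∃ s : Bdry d → G d, IsBorelSection s := by
  let k₁ : G d := if h : ∃ g : G d, lightRow g (Sum.inr 0) = lightRow g (Sum.inr 1)
    then kPart h.choose else 1
  let f : G d → G d := fun g => if lightRow g (Sum.inr 0) = lightRow g (Sum.inr 1) then k₁
    else kPart (oppHor (stereo g))
  have hf : ∀ g h : G d, proj g = proj h → f g = f h := by
    intro g h hgh
    obtain ⟨c, hc⟩ := proj_eq_iff.mp hgh
    have hc0 : c ≠ 0 := by
      rintro rfl
      have := lightRow_time_neg g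
      rw [hc] at this
      simp at this
    have hst : stereo g = stereo h := by
      funext i
      simp only [stereo, hc, Pi.smul_apply, smul_eq_mul, ← mul_sub]
      rw [neg_mul_eq_mul_neg, mul_div_mul_left _ _ hc0]
    simp only [f, hst, hc, Pi.smul_apply, smul_eq_mul, mul_right_inj' hc0]
  have hfm : Measurable f := by
    refine Measurable.ite ?_ measurable_const ?_
    · exact (isClosed_eq (continuous_lightRow _) (continuous_lightRow _)).measurableSet
    · exact (continuous_kPart.comp continuous_oppHor).measurable.comp measurable_stereo
  have hfK : ∀ g, f g ∈ K d ∧ proj (f g) = proj g := by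
    intro g
    by_cases hg : lightRow g (Sum.inr 0) = lightRow g (Sum.inr 1)
    · have hex : ∃ g : G d, lightRow g (Sum.inr 0) = lightRow g (Sum.inr 1) := ⟨g, hg⟩
      simp only [f, k₁, if_pos hg, dif_pos hex]
      refine ⟨kPart_mem _, ?_⟩
      rw [proj_kPart]
      exact proj_eq_of_lightRow_eq hex.choose_spec hg
    · simp only [f, if_neg hg]
      exact ⟨kPart_mem _, by rw [proj_kPart, proj_oppHor_stereo hg]⟩
  refine ⟨Quotient.lift f fun g h hgh => hf g h (Quotient.sound hgh),
    measurable_from_quotient.mpr hfm, fun ξ => ?_⟩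
  induction ξ using Quotient.inductionOn with
  | h g => exact hfK g

/-! ### The coordinates of a section -/

/-- The coordinates of a Borel section form a Borel isomorphism. -/
def coordEquiv (s : Bdry d → G d) (hs : IsBorelSection s) :
    (U d × M d × ℝ × Bdry d) ≃ᵐ G d where
  toFun := coord s
  invFun g := (⟨hor (horCoord g), hor_mem_U _⟩,
    ⟨kPart g * (s (proj g))⁻¹, mul_inv_mem_M (kPart_mem g) (hs.2 _).1
      ((proj_kPart g).trans (hs.2 _).2.symm)⟩, height g, proj g)
  left_inv := by
    rintro ⟨u, m, t, ξ⟩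
    have e : coord s (u, m, t, ξ) = hor (horCoord (u : G d)) * a d t * (m * s ξ) := by
      rw [coord, ← mem_U_iff.mp u.2, mul_assoc (u : G d) (a d t), ← mul_assoc (a d t),
        (mem_M_iff.mp m.2).2]
      simp only [mul_assoc]
    have hK : (m : G d) * s ξ ∈ K d := (K d).mul_mem (M_le_K m.2) (hs.2 ξ).1
    have h1 : horCoord (coord s (u, m, t, ξ)) = horCoord (u : G d) := by
      rw [e, horCoord_hor_mul_a_mul _ _ hK]
    have h2 : height (coord s (u, m, t, ξ)) = t := by
      rw [e, height_hor_mul_a_mul, height_of_mem_K hK, add_zero]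
    have h3 : proj (coord s (u, m, t, ξ)) = ξ :=
      (proj_mul_of_lightRow (lightRow_umat u.2 m.2 t) (s ξ)).trans (hs.2 ξ).2
    have h4 : kPart (coord s (u, m, t, ξ)) = m * s ξ := by
      rw [kPart, h1, h2, e, inv_mul_cancel_left]
    refine Prod.ext (Subtype.ext ?_) (Prod.ext (Subtype.ext ?_) (Prod.ext h2 h3))
    · change hor (horCoord (coord s (u, m, t, ξ))) = u
      rw [h1, ← mem_U_iff.mp u.2]
    · change kPart (coord s (u, m, t, ξ)) * (s (proj (coord s (u, m, t, ξ))))⁻¹ = m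
      rw [h4, h3, mul_inv_cancel_right]
  right_inv := by
    intro g
    have hm : kPart g * (s (proj g))⁻¹ ∈ M d := mul_inv_mem_M (kPart_mem g) (hs.2 _).1
      ((proj_kPart g).trans (hs.2 _).2.symm)
    change hor (horCoord g) * (kPart g * (s (proj g))⁻¹) * a d (height g) * s (proj g) = g
    rw [mul_assoc (hor (horCoord g)), ← (mem_M_iff.mp hm).2]
    conv_rhs => rw [iwasawa g]
    simp only [mul_assoc, inv_mul_cancel, mul_one]
  measurable_toFun := by
    refine Measurable.mul (Measurable.mul (Measurable.mul ?_ ?_) ?_) ?_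
    · exact measurable_subtype_coe.comp measurable_fst
    · exact measurable_subtype_coe.comp (measurable_fst.comp measurable_snd)
    · exact continuous_a.measurable.comp (measurable_fst.comp (measurable_snd.comp measurable_snd))
    · exact hs.1.comp (measurable_snd.comp (measurable_snd.comp measurable_snd))
  measurable_invFun := by
    refine Measurable.prodMk ?_ (Measurable.prodMk ?_ (Measurable.prodMk ?_ ?_))
    · exact (continuous_hor.comp continuous_horCoord).measurable.subtype_mk
    · exact (continuous_kPart.measurable.mul (hs.1.comp measurable_proj).inv).subtype_mk
    · exact continuous_height.measurable
    · exact measurable_proj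

/-! ### The Busemann function -/

lemma isBusemann_height {ξ : Bdry d} {k : G d} (hk : k ∈ K d) (hξ : proj k = ξ) (g : G d) :
    IsBusemann ξ g⁻¹ 1 (height (k * g)) := by
  refine ⟨kPart (k * g), kPart_mem _, ?_, k⁻¹, (K d).inv_mem hk,
    a d (-height (k * g)) * hor (horCoord (k * g)) * a d (height (k * g)), ?_, ?_⟩
  · rw [← act_proj, proj_kPart, act_proj, mul_inv_cancel_right, hξ]
  · have h := conj_hor (horCoord (k * g)) (-height (k * g))
    rw [neg_neg] at h
    rw [h]
    exact hor_mem_U _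
  · rw [kPart, a_neg]
    group

lemma isBusemann_unique {ξ : Bdry d} {k : G d} (hk : k ∈ K d) (hξ : proj k = ξ) {g : G d} {b : ℝ}
    (h : IsBusemann ξ g⁻¹ 1 b) : b = height (k * g) := by
  obtain ⟨k₀, hk₀, hξ₀, k', hk', u, hu, e⟩ := h
  have hbu : lightRow (a d b * u) = Real.exp (-b) • lightCov d := by
    rw [lightRow_mul_of_eq (lightRow_a b), lightRow_of_mem_U hu]
  have e1 : k'⁻¹ = a d b * u * (k₀ * g⁻¹) := by
    rw [one_mul] at e
    rw [← inv_inv (k₀ * g⁻¹), e]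
    group
  have e2 : proj k = proj k'⁻¹ := by rw [e1, proj_mul_of_lightRow hbu, hξ₀, hξ]
  have e3 : lightRow k = lightRow k'⁻¹ := lightRow_eq_of_mem_K hk ((K d).inv_mem hk') e2
  have e4 : lightRow (k * g) = lightRow (a d b * u * k₀) := by
    rw [lightRow_mul, e3, ← lightRow_mul, e1]
    congr 1
    group
  have e5 : height (k * g) = height (a d b * u * k₀) := by rw [height, height, e4]
  rw [e5, height_mul_of_eq hbu, height_of_mem_K hk₀, add_zero]

lemma busemann_eq {ξ : Bdry d} {k : G d} (hk : k ∈ K d) (hξ : proj k = ξ) (g : G d) :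
    busemann ξ g⁻¹ 1 = height (k * g) :=
  isBusemann_unique hk hξ (Classical.epsilon_spec ⟨_, isBusemann_height hk hξ g⟩)

/-! ### Generalities on measures -/

/-- A measure on `X × Y` whose slices `E ↦ lam (E × F)` are multiples of `h` is a product
`h × ν`. -/
lemma exists_eq_prod_of_slices {X Y : Type*} [MeasurableSpace X] [MeasurableSpace Y]
    (h : Measure X) [SigmaFinite h] {C : Set X} (hC : MeasurableSet C) (hC0 : h C ≠ 0)
    (hCt : h C ≠ ⊤) (lam : Measure (X × Y)) {S : ℕ → Set Y} (hSm : ∀ n, MeasurableSet (S n))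
    (hmono : Monotone S) (hS : ⋃ n, S n = Set.univ) (hfin : ∀ n, lam (C ×ˢ S n) < ⊤)
    (huniq : ∀ n E, MeasurableSet E → E ⊆ S n →
      ∃ k : ENNReal, (lam.restrict (Set.univ ×ˢ E)).map Prod.fst = k • h) :
    ∃ ν : Measure Y, (∀ n, ν (S n) < ⊤) ∧ lam = h.prod ν := by
  let ν : Measure Y := (h C)⁻¹ • (lam.restrict (C ×ˢ Set.univ)).map Prod.snd
  have hν : ∀ E, MeasurableSet E → ν E = (h C)⁻¹ * lam (C ×ˢ E) := by
    intro E hE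
    rw [Measure.smul_apply, smul_eq_mul, Measure.map_apply measurable_snd hE,
      Measure.restrict_apply (measurable_snd hE)]
    congr 2
    ext p
    simp [and_comm]
  have hνS : ∀ n, ν (S n) < ⊤ := fun n => by
    rw [hν _ (hSm n)]
    exact ENNReal.mul_lt_top (ENNReal.inv_lt_top.mpr (pos_iff_ne_zero.mpr hC0)) (hfin n)
  have hσ : SigmaFinite ν := by
    refine ⟨⟨⟨S, fun _ => trivial, hνS, hS⟩⟩⟩
  have small : ∀ n B E, MeasurableSet B → MeasurableSet E → E ⊆ S n →
      lam (B ×ˢ E) = h B * ν E := by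
    intro n B E hB hE hES
    obtain ⟨k, hk⟩ := huniq n E hE hES
    have key : ∀ B, MeasurableSet B → lam (B ×ˢ E) = k * h B := by
      intro B hB
      have h1 := congrArg (fun ρ => ρ B) hk
      simp only [Measure.smul_apply, smul_eq_mul] at h1
      rw [Measure.map_apply measurable_fst hB, Measure.restrict_apply (measurable_fst hB)] at h1
      rw [← h1]
      congr 1
      ext p
      simp
    rw [key B hB, hν E hE, key C hC, mul_comm k (h C), ← mul_assoc (h C)⁻¹,
      ENNReal.inv_mul_cancel hC0 hCt, one_mul, mul_comm]
  refine ⟨ν, hνS, ?_⟩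
  refine (Measure.prod_eq fun B E hB hE => ?_).symm
  have hU : E = ⋃ n, E ∩ S n := by rw [← Set.inter_iUnion, hS, Set.inter_univ]
  have hm : Monotone fun n => E ∩ S n := fun i j hij =>
    Set.inter_subset_inter_right _ (hmono hij)
  have hm' : Monotone fun n => B ×ˢ (E ∩ S n) := fun i j hij => Set.prod_mono le_rfl (hm hij)
  rw [hU, Set.prod_iUnion, hm'.measure_iUnion, hm.measure_iUnion, ENNReal.mul_iSup]
  exact iSup_congr fun n => small n B _ hB (hE.inter (hSm n)) Set.inter_subset_right

/-- A measure on `H × Y` which is invariant under left translations in the first factor is the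
product of a Haar measure with a measure on `Y`. -/
@[to_additive exists_eq_prod_of_forall_map_add_left]
lemma exists_eq_prod_of_forall_map_mul_left {H Y : Type*} [Group H] [TopologicalSpace H]
    [IsTopologicalGroup H] [LocallyCompactSpace H] [SecondCountableTopology H]
    [MeasurableSpace H] [BorelSpace H] [MeasurableSpace Y] (h : Measure H) [h.IsHaarMeasure]
    (lam : Measure (H × Y)) {S : ℕ → Set Y} (hSm : ∀ n, MeasurableSet (S n))
    (hmono : Monotone S) (hS : ⋃ n, S n = Set.univ)
    (hfin : ∀ C, IsCompact C → ∀ n, lam (C ×ˢ S n) < ⊤)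
    (hinv : ∀ g : H, lam.map (fun p => (g * p.1, p.2)) = lam) :
    ∃ ν : Measure Y, (∀ n, ν (S n) < ⊤) ∧ lam = h.prod ν := by
  obtain ⟨C, hCc, hCn⟩ := exists_compact_mem_nhds (1 : H)
  have hKc : IsCompact (closure C) := hCc.closure
  have hC0 : h (closure C) ≠ 0 :=
    (Measure.measure_pos_of_mem_nhds h (mem_of_superset hCn subset_closure)).ne'
  refine exists_eq_prod_of_slices h isClosed_closure.measurableSet hC0 hKc.measure_lt_top.ne lam
    hSm hmono hS (hfin _ hKc) fun n E hE hES => ?_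
  set ρ : Measure H := (lam.restrict (Set.univ ×ˢ E)).map Prod.fst with hρ
  have happ : ∀ B, MeasurableSet B → ρ B = lam (B ×ˢ E) := by
    intro B hB
    rw [hρ, Measure.map_apply measurable_fst hB, Measure.restrict_apply (measurable_fst hB)]
    congr 1
    ext p
    simp
  have hfc : IsFiniteMeasureOnCompacts ρ := by
    refine ⟨fun D hD => ?_⟩
    refine (measure_mono subset_closure).trans_lt ?_
    rw [happ _ isClosed_closure.measurableSet]
    exact (measure_mono (Set.prod_mono le_rfl hES)).trans_lt (hfin _ hD.closure n)
  have hli : ρ.IsMulLeftInvariant := by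
    refine ⟨fun g => ?_⟩
    ext B hB
    rw [Measure.map_apply (measurable_const_mul g) hB, happ _ (measurable_const_mul g hB),
      happ _ hB]
    have hgm : Measurable fun p : H × Y => (g * p.1, p.2) :=
      ((measurable_const_mul g).comp measurable_fst).prodMk measurable_snd
    conv_rhs => rw [← hinv g, Measure.map_apply hgm (hB.prod hE)]
    rfl
  exact ⟨_, Measure.isMulLeftInvariant_eq_smul ρ h⟩

/-- A measure which is invariant under an ergodic action and absolutely continuous with respect to
the ergodic measure is a multiple of it. -/
lemma exists_eq_smul_of_absolutelyContinuous {H X : Type*} [Group H] [MulAction H X]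
    [MeasurableSpace X] [MeasurableConstSMul H X] {μ ν : Measure X} [SigmaFinite μ] [SigmaFinite ν]
    [ErgodicSMul H X μ] [SMulInvariantMeasure H X ν] (hν : ν ≪ μ) :
    ∃ c : ENNReal, ν = c • μ := by
  set f := ν.rnDeriv μ with hf
  have hfm : Measurable f := Measure.measurable_rnDeriv ν μ
  have hνf : μ.withDensity f = ν := Measure.withDensity_rnDeriv_eq ν μ hν
  have hinv : ∀ g : H, (fun x => f (g • x)) =ᵐ[μ] f := by
    intro g
    have hgm : Measurable fun x => f (g • x) := hfm.comp (measurable_const_smul g)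
    rw [← withDensity_eq_iff_of_sigmaFinite hgm.aemeasurable hfm.aemeasurable, hνf]
    ext E hE
    have hE' : E = (fun x => g • x) ⁻¹' ((fun x => g⁻¹ • x) ⁻¹' E) := by
      ext x; simp
    rw [withDensity_apply _ hE]
    conv_lhs => rw [hE']
    rw [(measurePreserving_smul g μ).setLIntegral_comp_preimage
      (measurable_const_smul g⁻¹ hE) hfm,
      ← withDensity_apply _ (measurable_const_smul g⁻¹ hE), hνf, measure_preimage_smul]
  obtain ⟨c, hc⟩ : ∃ c, f =ᵐ[μ] Function.const X c := by
    refine exists_eventuallyEq_const_of_forall_separating MeasurableSet fun B hB => ?_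
    have hconst := ErgodicSMul.aeconst_of_forall_preimage_smul_ae_eq (G := H) (μ := μ)
      (hfm hB) fun g => ((hinv g).mono fun x (hx : f (g • x) = f x) => by
        change (g • x ∈ f ⁻¹' B) = (x ∈ f ⁻¹' B)
        simp only [Set.mem_preimage, hx])
    exact eventuallyConst_pred.mp hconst
  refine ⟨c, ?_⟩
  rw [← hνf, withDensity_congr_ae hc]
  exact withDensity_const c

/-- An additive function which is bounded above near zero is linear. -/
lemma eq_mul_of_additive_of_bddAbove {f : ℝ → ℝ} (hadd : ∀ r s, f (r + s) = f r + f s) {B : ℝ}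
    (hB : ∀ r, |r| ≤ 1 → f r ≤ B) (r : ℝ) : f r = f 1 * r := by
  let F : ℝ →+ ℝ := AddMonoidHom.mk' (fun r => f r - f 1 * r) fun r s => by rw [hadd]; ring
  have hF : ∀ r, F r = f r - f 1 * r := fun _ => rfl
  have hF1 : F 1 = 0 := by rw [hF]; ring
  have hbdd : ∀ r, F r ≤ B + |f 1| := by
    intro r
    have h1 : F r = F (Int.fract r) := by
      conv_lhs => rw [← Int.floor_add_fract r, map_add]
      have : F (⌊r⌋ : ℝ) = 0 := by
        have := map_zsmul F ⌊r⌋ (1 : ℝ)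
        rwa [hF1, smul_zero, zsmul_one] at this
      rw [this, zero_add]
    have h0 := Int.fract_nonneg r
    have h2 := (Int.fract_lt_one r).le
    have h3 : |Int.fract r| ≤ 1 := by rw [abs_of_nonneg h0]; exact h2
    rw [h1, hF]
    have h4 : -(f 1 * Int.fract r) ≤ |f 1| := by
      refine (neg_le_abs _).trans ?_
      rw [abs_mul]
      exact mul_le_of_le_one_right (abs_nonneg _) h3
    linarith [hB _ h3]
  have hle : ∀ r, F r ≤ 0 := by
    intro r
    by_contra! hr
    obtain ⟨n, hn⟩ := exists_nat_gt ((B + |f 1|) / F r)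
    rw [div_lt_iff₀ hr] at hn
    have := hbdd (n • r)
    rw [map_nsmul, nsmul_eq_mul] at this
    linarith
  have h1 := hle r
  have h2 := hle (-r)
  rw [map_neg] at h2
  have h3 : F r = 0 := by linarith
  rw [hF] at h3
  linarith

/-- A finite left Haar measure is right-invariant. -/
lemma isMulRightInvariant_of_isFiniteMeasure {H : Type*} [Group H] [TopologicalSpace H]
    [IsTopologicalGroup H] [LocallyCompactSpace H] [SecondCountableTopology H]
    [MeasurableSpace H] [BorelSpace H] (h : Measure H) [h.IsHaarMeasure] [IsFiniteMeasure h] :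
    h.IsMulRightInvariant := by
  refine ⟨fun g => ?_⟩
  have hfin : IsFiniteMeasure (h.map (· * g)) := Measure.isFiniteMeasure_map h _
  have hk := Measure.isMulLeftInvariant_eq_smul (h.map (· * g)) h
  set k := Measure.haarScalarFactor (h.map (· * g)) h
  have h1 := congrArg (fun ρ => ρ Set.univ) hk
  simp only [Measure.map_apply (measurable_mul_const g) MeasurableSet.univ, Set.preimage_univ,
    Measure.smul_apply] at h1
  have hne : h Set.univ ≠ 0 := (Measure.measure_pos_of_mem_nhds h (x := 1) univ_mem).ne'
  have hk1 : (k : ENNReal) = 1 := by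
    rw [ENNReal.smul_def, smul_eq_mul] at h1
    have := ENNReal.mul_left_inj hne (measure_ne_top h _) (a := 1) (b := k)
    rw [one_mul] at this
    exact (this.mp h1).symm
  rw [hk, ENNReal.coe_eq_one.mp hk1, one_smul]

variable {Γ : Subgroup (G d)}

/-! ### The lift of a measure on `G / Γ` -/

/-- The sum of `f` over the fibre of `G → G / Γ`. -/
def fibreSum (f : G d → ENNReal) (x : G d ⧸ Γ) : ENNReal :=
  ∑' g : (QuotientGroup.mk ⁻¹' {x} : Set (G d)), f (g : G d)

lemma fibreSum_mk (f : G d → ENNReal) (g : G d) :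
    fibreSum f (g : G d ⧸ Γ) = ∑' γ : Γ, f (g * γ) := by
  let e : Γ ≃ (QuotientGroup.mk ⁻¹' {(g : G d ⧸ Γ)} : Set (G d)) :=
    { toFun := fun γ => ⟨g * γ, QuotientGroup.mk_mul_of_mem g γ.2⟩
      invFun := fun h => ⟨g⁻¹ * h, QuotientGroup.eq.mp (Eq.symm h.2)⟩
      left_inv := fun γ => Subtype.ext (inv_mul_cancel_left g γ)
      right_inv := fun h => Subtype.ext (mul_inv_cancel_left g h) }
  exact (e.tsum_eq fun h => f (h : G d)).symm

lemma fibreSum_comp_mul_left (f : G d → ENNReal) (q : G d) (x : G d ⧸ Γ) :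
    fibreSum (fun g => f (q * g)) x = fibreSum f (q • x) := by
  induction x using QuotientGroup.induction_on with
  | H g =>
    rw [MulAction.Quotient.smul_coe, smul_eq_mul, fibreSum_mk, fibreSum_mk]
    simp only [mul_assoc]

lemma fibreSum_comp_mul_right (f : G d → ENNReal) {γ : G d} (hγ : γ ∈ Γ) (x : G d ⧸ Γ) :
    fibreSum (fun g => f (g * γ)) x = fibreSum f x := by
  induction x using QuotientGroup.induction_on with
  | H g =>
    rw [fibreSum_mk, fibreSum_mk]
    rw [← (Equiv.mulRight (⟨γ, hγ⟩ : Γ)).tsum_eq fun δ : Γ => f (g * δ)]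
    simp [mul_assoc]

instance : MeasurableConstSMul (G d) (G d ⧸ Γ) :=
  ⟨fun q => QuotientGroup.measurable_from_quotient.mpr
    (QuotientGroup.measurable_coe.comp (measurable_const_mul q))⟩

lemma U_smul_eq (u : U d) (x : G d ⧸ Γ) : u • x = (u : G d) • x := by
  induction x using QuotientGroup.induction_on with
  | H g => rfl

instance : MeasurableConstSMul (U d) (G d ⧸ Γ) := ⟨fun u => measurable_const_smul (u : G d)⟩

instance : OpensMeasurableSpace (G d ⧸ Γ) := by
  refine ⟨MeasurableSpace.generateFrom_le fun O hO => ?_⟩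
  have hO' : IsOpen O := hO
  exact (hO'.preimage QuotientGroup.continuous_mk).measurableSet

lemma IsLift.lintegral_eq {μ : Measure (G d ⧸ Γ)} {μt : Measure (G d)} (h : IsLift μ μt)
    {f : G d → ENNReal} (hf : Measurable f) : ∫⁻ g, f g ∂μt = ∫⁻ x, fibreSum f x ∂μ := h f hf

lemma exists_nhds_one_disjoint_translates {H : Type*} [Group H] [TopologicalSpace H]
    [IsTopologicalGroup H] (Γ : Subgroup H) [DiscreteTopology Γ] :
    ∃ V : Set H, IsOpen V ∧ 1 ∈ V ∧ ∀ v ∈ V, ∀ w ∈ V, v⁻¹ * w ∈ Γ → v⁻¹ * w = 1 := by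
  obtain ⟨O, hO, hO1⟩ := isOpen_induced_iff.mp (isOpen_discrete ({1} : Set Γ))
  have h1 : (1 : H) ∈ O := by
    have : (1 : Γ) ∈ (Subtype.val ⁻¹' O : Set Γ) := by rw [hO1]; rfl
    exact this
  have hcont : Continuous fun p : H × H => p.1⁻¹ * p.2 := by fun_prop
  have hnhds : (fun p : H × H => p.1⁻¹ * p.2) ⁻¹' O ∈ 𝓝 ((1 : H), (1 : H)) :=
    (hO.preimage hcont).mem_nhds (by rwa [Set.mem_preimage, inv_one, mul_one])
  rw [nhds_prod_eq] at hnhds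
  obtain ⟨V, hV, hVO⟩ := mem_prod_same_iff.mp hnhds
  obtain ⟨W, hWV, hW, hW1⟩ := mem_nhds_iff.mp hV
  refine ⟨W, hW, hW1, fun v hv w hw hΓ => ?_⟩
  have h2 : v⁻¹ * w ∈ O := hVO (Set.mk_mem_prod (hWV hv) (hWV hw))
  have h3 : (⟨v⁻¹ * w, hΓ⟩ : Γ) ∈ (Subtype.val ⁻¹' O : Set Γ) := h2
  rw [hO1] at h3
  exact congrArg Subtype.val h3

lemma IsLift.map_mul_right {μ : Measure (G d ⧸ Γ)} {μt : Measure (G d)} (h : IsLift μ μt)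
    {γ : G d} (hγ : γ ∈ Γ) : μt.map (· * γ) = μt := by
  refine Measure.ext_of_lintegral _ fun f hf => ?_
  rw [lintegral_map hf (measurable_mul_const γ),
    h.lintegral_eq (f := fun g => f (g * γ)) (hf.comp (measurable_mul_const γ)), h.lintegral_eq hf]
  exact lintegral_congr fun x => fibreSum_comp_mul_right f hγ x

lemma IsLift.ne_zero {μ : Measure (G d ⧸ Γ)} {μt : Measure (G d)} (h : IsLift μ μt)
    (hμ : μ ≠ 0) : μt ≠ 0 := by
  rintro rfl
  apply hμ
  rw [← Measure.measure_univ_eq_zero, ← nonpos_iff_eq_zero]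
  have h1 := h.lintegral_eq (measurable_const (a := (1 : ENNReal)))
  rw [lintegral_zero_measure] at h1
  rw [h1, ← lintegral_one]
  refine lintegral_mono fun x => ?_
  induction x using QuotientGroup.induction_on with
  | H g =>
    rw [fibreSum_mk]
    exact ENNReal.le_tsum (1 : Γ)

section Discrete

variable [DiscreteTopology Γ]

lemma measurable_fibreSum {f : G d → ENNReal} (hf : Measurable f) :
    Measurable (fibreSum f : G d ⧸ Γ → ENNReal) := by
  have : Countable Γ := countable_of_Lindelof_of_discrete
  refine QuotientGroup.measurable_from_quotient.mpr ?_
  have h : (fibreSum f : G d ⧸ Γ → ENNReal) ∘ ((↑) : G d → G d ⧸ Γ) =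
      fun g => ∑' γ : Γ, f (g * γ) := funext fun g => fibreSum_mk f g
  rw [h]
  exact Measurable.tsum fun γ => hf.comp (measurable_mul_const _)

theorem exists_isLift (μ : Measure (G d ⧸ Γ)) : ∃ μt : Measure (G d), IsLift μ μt := by
  let κ : G d ⧸ Γ → Measure (G d) := fun x =>
    Measure.sum fun g : (QuotientGroup.mk ⁻¹' {x} : Set (G d)) => Measure.dirac (g : G d)
  have hint : ∀ (f : G d → ENNReal), Measurable f → ∀ x, ∫⁻ g, f g ∂κ x = fibreSum f x := by
    intro f hf x
    rw [lintegral_sum_measure]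
    exact tsum_congr fun g => lintegral_dirac' _ hf
  have hκ : Measurable κ := by
    refine Measure.measurable_of_measurable_coe _ fun E hE => ?_
    have h1 : Measurable (E.indicator (1 : G d → ENNReal)) := measurable_one.indicator hE
    have h2 : (fun x => κ x E) = fibreSum (E.indicator 1) := by
      funext x
      rw [← hint _ h1, lintegral_indicator_one hE]
    rw [h2]
    exact measurable_fibreSum h1
  refine ⟨μ.bind κ, fun f hf => ?_⟩
  rw [Measure.lintegral_bind hκ.aemeasurable hf.aemeasurable]
  exact lintegral_congr fun x => hint f hf x

variable {μ : Measure (G d ⧸ Γ)} {μt : Measure (G d)}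

lemma IsLift.map_mul_left (h : IsLift μ μt) {q : G d} {c : ENNReal}
    (hq : μ.map (fun x => q • x) = c • μ) : μt.map (q * ·) = c • μt := by
  refine Measure.ext_of_lintegral _ fun f hf => ?_
  rw [lintegral_map hf (measurable_const_mul q),
    h.lintegral_eq (f := fun g => f (q * g)) (hf.comp (measurable_const_mul q)),
    lintegral_smul_measure, h.lintegral_eq hf]
  have e : ∀ x : G d ⧸ Γ, fibreSum (fun g => f (q * g)) x = fibreSum f (q • x) :=
    fibreSum_comp_mul_left f q
  rw [lintegral_congr e, ← lintegral_map (measurable_fibreSum hf) (measurable_const_smul q), hq,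
    lintegral_smul_measure]

lemma IsLift.isLocallyFiniteMeasure [IsLocallyFiniteMeasure μ] (h : IsLift μ μt) :
    IsLocallyFiniteMeasure μt := by
  refine ⟨fun g₀ => ?_⟩
  obtain ⟨V, hV, hV1, hVΓ⟩ := exists_nhds_one_disjoint_translates Γ
  obtain ⟨W, hWg, hW, hWμ⟩ := μ.exists_isOpen_measure_lt_top (g₀ : G d ⧸ Γ)
  set O : Set (G d) := (fun g => g₀⁻¹ * g) ⁻¹' V ∩ QuotientGroup.mk ⁻¹' W with hO
  have hOo : IsOpen O :=
    (hV.preimage (continuous_const.mul continuous_id)).inter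
      (hW.preimage QuotientGroup.continuous_mk)
  refine ⟨O, hOo.mem_nhds ⟨by simpa using hV1, hWg⟩, ?_⟩
  rw [← lintegral_indicator_one hOo.measurableSet,
    h.lintegral_eq (measurable_one.indicator hOo.measurableSet)]
  refine lt_of_le_of_lt ?_ hWμ
  rw [← lintegral_indicator_one hW.measurableSet]
  refine lintegral_mono fun x => ?_
  induction x using QuotientGroup.induction_on with
  | H g =>
    rw [fibreSum_mk]
    by_cases hex : ∃ γ : Γ, g * γ ∈ O
    · obtain ⟨γ, hγ⟩ := hex
      have hgW : (g : G d ⧸ Γ) ∈ W := by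
        have := hγ.2
        rwa [Set.mem_preimage, QuotientGroup.mk_mul_of_mem g γ.2] at this
      rw [tsum_eq_single γ, Set.indicator_of_mem hγ, Set.indicator_of_mem hgW]
      · rfl
      intro δ hδ
      refine Set.indicator_of_notMem (fun hδO => hδ ?_) _
      have e : (g₀⁻¹ * (g * γ))⁻¹ * (g₀⁻¹ * (g * δ)) = (γ : G d)⁻¹ * δ := by group
      have h1 := hVΓ _ hγ.1 _ hδO.1 (by rw [e]; exact (γ⁻¹ * δ).2)
      rw [e, inv_mul_eq_one] at h1
      exact Subtype.ext h1.symm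
    · push Not at hex
      have : ∀ γ : Γ, O.indicator (1 : G d → ENNReal) (g * γ) = 0 := fun γ =>
        Set.indicator_of_notMem (hex γ) _
      simp [this]

end Discrete

/-! ### Quasi-invariance and ergodicity -/

lemma exists_map_smul_eq_smul {μ : Measure (G d ⧸ Γ)} [IsLocallyFiniteMeasure μ]
    [ErgodicSMul (U d) (G d ⧸ Γ) μ] (hμ : μ ≠ 0) (hMA : IsQuasiInvariantMA μ) {m : G d}
    (hm : m ∈ M d) (t : ℝ) :
    ∃ c : ENNReal, c ≠ 0 ∧ μ.map (fun x => (m * a d t) • x) = c • μ := by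
  set q := m * a d t with hq
  have : SecondCountableTopology (G d ⧸ Γ) := inferInstance
  have : SigmaFinite μ := inferInstance
  have hqm : Measurable fun x : G d ⧸ Γ => q • x := measurable_const_smul q
  have hσ : SigmaFinite (μ.map fun x => q • x) := (MeasurableEquiv.smul q).sigmaFinite_map
  have hinv : SMulInvariantMeasure (U d) (G d ⧸ Γ) (μ.map fun x => q • x) := by
    refine ⟨fun u E hE => ?_⟩
    have hu : q⁻¹ * u * q ∈ U d := by
      have := conj_mem_U (q := q⁻¹) (fun r => ?_) u.2
      · rwa [inv_inv] at this
      · rw [eq_inv_mul_iff_mul_eq, ← mul_assoc, ← a_mul_comm_of_MA hm, mul_assoc, mul_inv_cancel,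
          mul_one]
    rw [Measure.map_apply hqm (measurable_const_smul u hE), Measure.map_apply hqm hE,
      ← measure_preimage_smul μ (⟨_, hu⟩ : U d) ((fun x => q • x) ⁻¹' E)]
    congr 1
    ext x
    have e : (u : G d) * q = q * (q⁻¹ * u * q) := by group
    rw [Set.mem_preimage, Set.mem_preimage, Set.mem_preimage, Set.mem_preimage, U_smul_eq,
      U_smul_eq, smul_smul, smul_smul, e]
  obtain ⟨c, hc⟩ := exists_eq_smul_of_absolutelyContinuous (H := U d) (hMA m hm t).1
  refine ⟨c, ?_, hc⟩
  rintro rfl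
  have h1 := (hMA m hm t).2
  rw [← hq, hc, zero_smul] at h1
  exact hμ (Measure.absolutelyContinuous_zero_iff.mp h1)

instance (H : Subgroup (G d)) : SecondCountableTopology H :=
  TopologicalSpace.Subtype.secondCountableTopology (H : Set (G d))

/-! ### Translations along the fibres of the coordinates -/

/-- A skew right translation of a product with a right-invariant factor. -/
lemma map_skew_mul_right {H Y Z : Type*} [Group H] [MeasurableSpace H] [MeasurableMul₂ H]
    [MeasurableSpace Y] [MeasurableSpace Z] (h : Measure H) [SFinite h] [h.IsMulRightInvariant]
    (ρ : Measure Y) [SFinite ρ] {v : Y → H} (hv : Measurable v) {T : Y → Z} (hT : Measurable T) :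
    (h.prod ρ).map (fun p => (p.1 * v p.2, T p.2)) = h.prod (ρ.map T) := by
  have hm : Measurable fun p : H × Y => (p.1 * v p.2, T p.2) :=
    (measurable_fst.mul (hv.comp measurable_snd)).prodMk (hT.comp measurable_snd)
  refine Measure.ext_of_lintegral _ fun f hf => ?_
  have hfm : Measurable fun p : H × Y => f (p.1 * v p.2, T p.2) := hf.comp hm
  rw [lintegral_map hf hm, lintegral_prod_symm _ hfm.aemeasurable,
    lintegral_prod_symm _ hf.aemeasurable, lintegral_map hf.lintegral_prod_left' hT]
  exact lintegral_congr fun y => lintegral_mul_right_eq_self (fun x => f (x, T y)) (v y)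

/-- The density `e^{βt}`. -/
def expDens (β t : ℝ) : ENNReal := ENNReal.ofReal (Real.exp (β * t))

lemma measurable_expDens (β : ℝ) : Measurable (expDens β) := by
  unfold expDens
  fun_prop

lemma expDens_add (β s t : ℝ) : expDens β (s + t) = expDens β s * expDens β t := by
  rw [expDens, expDens, expDens, ← ENNReal.ofReal_mul (Real.exp_pos _).le, ← Real.exp_add, mul_add]

lemma expDens_zero (β : ℝ) : expDens β 0 = 1 := by simp [expDens]

lemma map_skew_add {Y Z : Type*} [MeasurableSpace Y] [MeasurableSpace Z] (β : ℝ) (ρ : Measure Y)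
    [SFinite ρ] {τ : Y → ℝ} (hτ : Measurable τ) {T : Y → Z} (hT : Measurable T) :
    ((volume.withDensity (expDens β)).prod ρ).map (fun p => (p.1 + τ p.2, T p.2)) =
      (volume.withDensity (expDens β)).prod
        ((ρ.withDensity fun y => expDens β (-τ y)).map T) := by
  have hm : Measurable fun p : ℝ × Y => (p.1 + τ p.2, T p.2) :=
    (measurable_fst.add (hτ.comp measurable_snd)).prodMk (hT.comp measurable_snd)
  have hd : Measurable fun y => expDens β (-τ y) := (measurable_expDens β).comp hτ.neg
  refine Measure.ext_of_lintegral _ fun f hf => ?_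
  have hfm : Measurable fun p : ℝ × Y => f (p.1 + τ p.2, T p.2) := hf.comp hm
  have hfT : Measurable fun y => ∫⁻ t, f (t, T y) ∂(volume.withDensity (expDens β)) :=
    hf.lintegral_prod_left'.comp hT
  rw [lintegral_map hf hm, lintegral_prod_symm _ hfm.aemeasurable,
    lintegral_prod_symm _ hf.aemeasurable, lintegral_map hf.lintegral_prod_left' hT,
    lintegral_withDensity_eq_lintegral_mul _ hd hfT]
  refine lintegral_congr fun y => ?_
  have hfy : Measurable fun t => f (t, T y) := hf.comp measurable_prodMk_right
  have hfy' : Measurable fun t => f (t + τ y, T y) := hfy.comp (measurable_add_const (τ y))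
  rw [lintegral_withDensity_eq_lintegral_mul _ (measurable_expDens β) hfy', Pi.mul_apply,
    lintegral_withDensity_eq_lintegral_mul _ (measurable_expDens β) hfy,
    ← lintegral_const_mul _ ((measurable_expDens β).mul hfy),
    ← lintegral_add_right_eq_self (fun t => expDens β (-τ y) *
      ((expDens β * fun t => f (t, T y)) t)) (τ y)]
  refine lintegral_congr fun t => ?_
  simp only [Pi.mul_apply]
  rw [← mul_assoc, ← expDens_add]
  congr 2
  ring

lemma prod_left_cancel {X Y : Type*} [MeasurableSpace X] [MeasurableSpace Y] {h : Measure X}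
    {C : Set X} (hC0 : h C ≠ 0) (hCt : h C ≠ ⊤) {ρ ρ' : Measure Y} [SFinite ρ] [SFinite ρ']
    (e : h.prod ρ = h.prod ρ') : ρ = ρ' := by
  ext E _
  have h1 := congrArg (fun κ => κ (C ×ˢ E)) e
  simp only [Measure.prod_prod] at h1
  exact (ENNReal.mul_right_inj hC0 hCt).mp h1

lemma exists_measure_ne {H : Type*} [Group H] [TopologicalSpace H] [IsTopologicalGroup H]
    [LocallyCompactSpace H] [MeasurableSpace H] [BorelSpace H] (h : Measure H) [h.IsHaarMeasure] :
    ∃ C, h C ≠ 0 ∧ h C ≠ ⊤ := by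
  obtain ⟨C, hCc, hCn⟩ := exists_compact_mem_nhds (1 : H)
  exact ⟨C, (Measure.measure_pos_of_mem_nhds h hCn).ne', hCc.measure_lt_top.ne⟩

lemma coordMeasure_eq (du : Measure (U d)) (dm : Measure (M d))
    (β : ℝ) (ν : Measure (Bdry d)) : coordMeasure du dm β ν =
    du.prod (dm.prod (((volume : Measure ℝ).withDensity (expDens β)).prod ν)) := rfl

lemma measurable_coord {s : Bdry d → G d} (hs : IsBorelSection s) : Measurable (coord s) :=
  (coordEquiv s hs).measurable

section Coord

variable (du : Measure (U d)) [du.IsHaarMeasure] (dm : Measure (M d)) [dm.IsHaarMeasure]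

lemma isMulRightInvariant_U : du.IsMulRightInvariant := by
  refine ⟨fun u => ?_⟩
  have h : (fun v : U d => v * u) = fun v => u * v := funext fun v => U_mul_comm v u
  rw [h]
  exact map_mul_left_eq_self du u

lemma isMulRightInvariant_M : dm.IsMulRightInvariant := isMulRightInvariant_of_isFiniteMeasure dm

instance (β : ℝ) : SigmaFinite ((volume : Measure ℝ).withDensity (expDens β)) :=
  SigmaFinite.withDensity_of_ne_top (Eventually.of_forall fun _ => ENNReal.ofReal_ne_top)

lemma map_coordMeasure (β : ℝ) (ν : Measure (Bdry d)) [IsFiniteMeasure ν]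
    {v : M d × ℝ × Bdry d → U d} (hv : Measurable v) {n : Bdry d → M d} (hn : Measurable n)
    {τ : Bdry d → ℝ} (hτ : Measurable τ) {σ : Bdry d → Bdry d} (hσ : Measurable σ) :
    (coordMeasure du dm β ν).map (fun p => (p.1 * v p.2, p.2.1 * n p.2.2.2,
      p.2.2.1 + τ p.2.2.2, σ p.2.2.2)) =
    coordMeasure du dm β ((ν.withDensity fun ξ => expDens β (-τ ξ)).map σ) := by
  have := isMulRightInvariant_U du
  have := isMulRightInvariant_M dm
  have hT : Measurable fun y : ℝ × Bdry d => (y.1 + τ y.2, σ y.2) :=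
    (measurable_fst.add (hτ.comp measurable_snd)).prodMk (hσ.comp measurable_snd)
  have hT' : Measurable fun y : M d × ℝ × Bdry d => (y.1 * n y.2.2, y.2.1 + τ y.2.2, σ y.2.2) :=
    (measurable_fst.mul (hn.comp (measurable_snd.comp measurable_snd))).prodMk
      (hT.comp measurable_snd)
  rw [coordMeasure_eq, coordMeasure_eq, map_skew_mul_right du _ hv hT',
    map_skew_mul_right dm _ (v := fun y : ℝ × Bdry d => n y.2) (hn.comp measurable_snd) hT,
    map_skew_add β ν hτ hσ]

lemma coordMeasure_injective (β : ℝ) {ν ν' : Measure (Bdry d)} [SFinite ν] [SFinite ν']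
    (h : coordMeasure du dm β ν = coordMeasure du dm β ν') : ν = ν' := by
  obtain ⟨C, hC0, hCt⟩ := exists_measure_ne du
  obtain ⟨D, hD0, hDt⟩ := exists_measure_ne dm
  rw [coordMeasure_eq, coordMeasure_eq] at h
  have h2 := prod_left_cancel hD0 hDt (prod_left_cancel hC0 hCt h)
  have hI : (volume.withDensity (expDens β)) (Set.Icc (0 : ℝ) 1) ≠ 0 := by
    rw [Ne, withDensity_apply_eq_zero (measurable_expDens β)]
    have : {x | expDens β x ≠ 0} ∩ Set.Icc (0 : ℝ) 1 = Set.Icc 0 1 := by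
      refine Set.inter_eq_right.mpr fun x _ => ?_
      exact (ENNReal.ofReal_pos.mpr (Real.exp_pos _)).ne'
    rw [this]
    simp
  have hIt : (volume.withDensity (expDens β)) (Set.Icc (0 : ℝ) 1) ≠ ⊤ := by
    rw [withDensity_apply _ measurableSet_Icc]
    have hcont : Continuous fun t : ℝ => Real.exp (β * t) := by fun_prop
    exact (hcont.continuousOn.integrableOn_compact isCompact_Icc).lintegral_lt_top.ne
  exact prod_left_cancel hI hIt h2

/-- The representation of a measure in the coordinates of a section does not depend on the
section. -/
theorem map_coord_eq_of_isBorelSection (β : ℝ) (ν : Measure (Bdry d)) [IsFiniteMeasure ν]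
    {s s' : Bdry d → G d} (hs : IsBorelSection s) (hs' : IsBorelSection s') :
    (coordMeasure du dm β ν).map (coord s') = (coordMeasure du dm β ν).map (coord s) := by
  have hM : ∀ ξ, s' ξ * (s ξ)⁻¹ ∈ M d := fun ξ =>
    mul_inv_mem_M (hs'.2 ξ).1 (hs.2 ξ).1 ((hs'.2 ξ).2.trans (hs.2 ξ).2.symm)
  let n : Bdry d → M d := fun ξ => ⟨s' ξ * (s ξ)⁻¹, hM ξ⟩
  have hn : Measurable n := (hs'.1.mul hs.1.inv).subtype_mk
  let v : M d × ℝ × Bdry d → U d := fun _ => 1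
  let τ : Bdry d → ℝ := fun _ => 0
  have hv : Measurable v := measurable_const
  have hτ : Measurable τ := measurable_const
  let T : U d × M d × ℝ × Bdry d → U d × M d × ℝ × Bdry d := fun p =>
    (p.1 * v p.2, p.2.1 * n p.2.2.2, p.2.2.1 + τ p.2.2.2, id p.2.2.2)
  have hTm : Measurable T := by
    refine (measurable_fst.mul (hv.comp measurable_snd)).prodMk (.prodMk ?_ (.prodMk ?_ ?_))
    · exact (measurable_fst.comp measurable_snd).mul
        (hn.comp (measurable_snd.comp (measurable_snd.comp measurable_snd)))
    · exact (measurable_fst.comp (measurable_snd.comp measurable_snd)).add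
        (hτ.comp (measurable_snd.comp (measurable_snd.comp measurable_snd)))
    · exact measurable_snd.comp (measurable_snd.comp measurable_snd)
  have hT : coord s' = coord s ∘ T := by
    funext p
    change (p.1 : G d) * p.2.1 * a d p.2.2.1 * s' p.2.2.2 =
      (p.1 : G d) * 1 * (p.2.1 * (s' p.2.2.2 * (s p.2.2.2)⁻¹)) * a d (p.2.2.1 + 0) * s p.2.2.2
    rw [mul_one, add_zero, ← mul_assoc (p.1 : G d), mul_assoc ((p.1 : G d) * p.2.1) _ (a d _),
      ← (mem_M_iff.mp (hM p.2.2.2)).2]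
    simp only [mul_assoc, inv_mul_cancel, mul_one]
  have h := map_coordMeasure du dm β ν hv hn hτ measurable_id
  have hw : (ν.withDensity fun ξ => expDens β (-τ ξ)).map id = ν := by
    rw [Measure.map_id]
    simp only [τ, neg_zero, expDens_zero]
    exact withDensity_one
  rw [hw] at h
  rw [hT, ← Measure.map_map (measurable_coord hs) hTm]
  exact congrArg (Measure.map (coord s)) h

/-- Invariance under right translation by `Γ` means that the boundary measure is conformal. -/
theorem isConformal_of_map_mul_right {β : ℝ} {ν : Measure (Bdry d)} [IsFiniteMeasure ν]
    {s : Bdry d → G d} (hs : IsBorelSection s)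
    (hinv : ∀ γ ∈ Γ, ((coordMeasure du dm β ν).map (coord s)).map (· * γ) =
      (coordMeasure du dm β ν).map (coord s)) : IsConformal Γ β ν := by
  intro γ hγ
  let e := coordEquiv s hs
  let c : Bdry d → U d × M d × ℝ × Bdry d := fun ξ => e.symm (s ξ * γ⁻¹)
  have hc : Measurable c := e.symm.measurable.comp (hs.1.mul_const _)
  let n : Bdry d → M d := fun ξ => (c ξ).2.1
  let τ : Bdry d → ℝ := fun ξ => (c ξ).2.2.1
  let σ : Bdry d → Bdry d := fun ξ => act ξ γ⁻¹
  have hn : Measurable n := (measurable_fst.comp measurable_snd).comp hc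
  have hτ : Measurable τ := (measurable_fst.comp (measurable_snd.comp measurable_snd)).comp hc
  have hσ : Measurable σ := measurable_act _
  have hσc : ∀ ξ, (c ξ).2.2.2 = σ ξ := by
    intro ξ
    change proj (s ξ * γ⁻¹) = act ξ γ⁻¹
    rw [← act_proj, (hs.2 ξ).2]
  have hcs : ∀ ξ, s ξ * γ⁻¹ = (c ξ).1 * n ξ * a d (τ ξ) * s (σ ξ) := by
    intro ξ
    rw [← hσc]
    exact (e.apply_symm_apply (s ξ * γ⁻¹)).symm
  let v : M d × ℝ × Bdry d → U d := fun y =>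
    ⟨(y.1 * a d y.2.1) * (c y.2.2).1 * (y.1 * a d y.2.1)⁻¹,
      conj_mem_U (a_mul_comm_of_MA y.1.2 _) (c y.2.2).1.2⟩
  have hv : Measurable v := by
    have h1 : Measurable fun y : M d × ℝ × Bdry d => (y.1 : G d) * a d y.2.1 :=
      (measurable_subtype_coe.comp measurable_fst).mul
        (continuous_a.measurable.comp (measurable_fst.comp measurable_snd))
    have h2 : Measurable fun y : M d × ℝ × Bdry d => ((c y.2.2).1 : G d) :=
      measurable_subtype_coe.comp
        (measurable_fst.comp (hc.comp (measurable_snd.comp measurable_snd)))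
    exact ((h1.mul h2).mul h1.inv).subtype_mk
  let T : U d × M d × ℝ × Bdry d → U d × M d × ℝ × Bdry d := fun p =>
    (p.1 * v p.2, p.2.1 * n p.2.2.2, p.2.2.1 + τ p.2.2.2, σ p.2.2.2)
  have hTm : Measurable T := by
    refine (measurable_fst.mul (hv.comp measurable_snd)).prodMk (.prodMk ?_ (.prodMk ?_ ?_))
    · exact (measurable_fst.comp measurable_snd).mul
        (hn.comp (measurable_snd.comp (measurable_snd.comp measurable_snd)))
    · exact (measurable_fst.comp (measurable_snd.comp measurable_snd)).add
        (hτ.comp (measurable_snd.comp (measurable_snd.comp measurable_snd)))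
    · exact hσ.comp (measurable_snd.comp (measurable_snd.comp measurable_snd))
  have hT : (· * γ⁻¹) ∘ coord s = coord s ∘ T := by
    funext p
    obtain ⟨u, m, t, ξ⟩ := p
    change (u : G d) * m * a d t * s ξ * γ⁻¹ =
      (u : G d) * (m * a d t * (c ξ).1 * (m * a d t)⁻¹) * (m * n ξ) * a d (t + τ ξ) * s (σ ξ)
    rw [mul_assoc _ (s ξ), hcs, a_add]
    have hcomm := (mem_M_iff.mp (n ξ).2).2 t
    calc (u : G d) * m * a d t * ((c ξ).1 * n ξ * a d (τ ξ) * s (σ ξ))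
        = u * (m * a d t * (c ξ).1 * (m * a d t)⁻¹) * m * (a d t * n ξ) * a d (τ ξ) * s (σ ξ) := by
          group
      _ = _ := by rw [hcomm]; simp only [mul_assoc]
  have hmap : (coordMeasure du dm β ν).map T = coordMeasure du dm β ν := by
    have h1 := hinv γ⁻¹ (Γ.inv_mem hγ)
    rw [Measure.map_map (measurable_mul_const _) (measurable_coord hs), hT,
      ← Measure.map_map (measurable_coord hs) hTm] at h1
    exact e.map_measurableEquiv_injective h1
  have hν : (ν.withDensity fun ξ => expDens β (-τ ξ)).map σ = ν := by
    refine coordMeasure_injective du dm β ?_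
    rw [← map_coordMeasure du dm β ν hv hn hτ hσ]
    exact hmap
  have hdens : ∀ ξ, busemann ξ γ⁻¹ 1 = height (s ξ * γ) := fun ξ =>
    busemann_eq (hs.2 ξ).1 (hs.2 ξ).2 γ
  have hcocycle : ∀ ξ, height (s (σ ξ) * γ) = -τ ξ := by
    intro ξ
    have h1 : s ξ = (c ξ).1 * n ξ * a d (τ ξ) * (s (σ ξ) * γ) := by
      rw [← mul_assoc, ← hcs, inv_mul_cancel_right]
    have h2 := congrArg height h1
    rw [height_of_mem_K (hs.2 ξ).1, height_mul_of_eq (lightRow_umat (c ξ).1.2 (n ξ).2 (τ ξ))] at h2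
    linarith
  have hD : (fun ξ : Bdry d => ENNReal.ofReal (Real.exp (-β * busemann ξ γ⁻¹ 1))) =
      fun ξ => expDens β (-height (s ξ * γ)) := by
    funext ξ
    rw [hdens, expDens, neg_mul, mul_neg]
  have hDm : Measurable fun ξ : Bdry d => expDens β (-height (s ξ * γ)) :=
    (measurable_expDens β).comp (continuous_height.measurable.comp (hs.1.mul_const γ)).neg
  rw [hD]
  refine Measure.ext_of_lintegral _ fun f hf => ?_
  rw [lintegral_map hf hσ, lintegral_withDensity_eq_lintegral_mul _ hDm hf]
  conv_rhs => rw [← hν]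
  have hτm : Measurable fun ξ => expDens β (-τ ξ) := (measurable_expDens β).comp hτ.neg
  have hDf : Measurable fun ξ => ((fun ξ => expDens β (-height (s ξ * γ))) * f) (σ ξ) :=
    (hDm.mul hf).comp hσ
  rw [lintegral_map (hDm.mul hf) hσ, lintegral_withDensity_eq_lintegral_mul _ hτm hDf]
  refine lintegral_congr fun ξ => ?_
  simp only [Pi.mul_apply]
  rw [hcocycle, ← mul_assoc, ← expDens_add, neg_neg, neg_add_cancel, expDens_zero, one_mul]

end Coord

/-! ### The product structure of a measure on `G` -/

/-- Conjugation of `U` by an element which commutes with the flow. -/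
def conjU {q : G d} (hq : ∀ t, a d t * q = q * a d t) : U d ≃* U d where
  toFun u := ⟨q * u * q⁻¹, conj_mem_U hq u.2⟩
  invFun u := ⟨q⁻¹ * u * q, by
    have h := conj_mem_U (q := q⁻¹) (fun t => by
      rw [eq_inv_mul_iff_mul_eq, ← mul_assoc, ← hq, mul_assoc, mul_inv_cancel, mul_one]) u.2
    rwa [inv_inv] at h⟩
  left_inv u := Subtype.ext (by change q⁻¹ * (q * u * q⁻¹) * q = u; group)
  right_inv u := Subtype.ext (by change q * (q⁻¹ * u * q) * q⁻¹ = u; group)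
  map_mul' u v := Subtype.ext (by
    change q * (u * v) * q⁻¹ = (q * u * q⁻¹) * (q * v * q⁻¹); group)

lemma continuous_conjU {q : G d} (hq : ∀ t, a d t * q = q * a d t) : Continuous (conjU hq) :=
  ((continuous_const.mul continuous_subtype_val).mul continuous_const).subtype_mk _

lemma continuous_conjU_symm {q : G d} (hq : ∀ t, a d t * q = q * a d t) :
    Continuous (conjU hq).symm :=
  ((continuous_const.mul continuous_subtype_val).mul continuous_const).subtype_mk _

lemma exists_map_conjU (du : Measure (U d)) [du.IsHaarMeasure] {q : G d}
    (hq : ∀ t, a d t * q = q * a d t) :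
    ∃ c : ENNReal, c ≠ 0 ∧ c ≠ ⊤ ∧ du.map (conjU hq) = c • du := by
  have := (conjU hq).isHaarMeasure_map du (continuous_conjU hq) (continuous_conjU_symm hq)
  refine ⟨Measure.haarScalarFactor (du.map (conjU hq)) du, ?_, ENNReal.coe_ne_top,
    Measure.isMulLeftInvariant_eq_smul _ du⟩
  exact_mod_cast ne_of_gt (Measure.haarScalarFactor_pos_of_isHaarMeasure _ _)

/-- The sets `M × [-n, n] × S^{d-1}`. -/
def slab (d n : ℕ) : Set (M d × ℝ × Bdry d) := Set.univ ×ˢ (Set.Icc (-n : ℝ) n ×ˢ Set.univ)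

lemma mem_slab {n : ℕ} {y : M d × ℝ × Bdry d} : y ∈ slab d n ↔ |y.2.1| ≤ n := by
  simp [slab, abs_le]

lemma measurableSet_slab (n : ℕ) : MeasurableSet (slab d n) :=
  MeasurableSet.univ.prod (measurableSet_Icc.prod MeasurableSet.univ)

lemma monotone_slab : Monotone (slab d) := fun i j hij y hy => by
  rw [mem_slab] at hy ⊢
  exact hy.trans (Nat.cast_le.mpr hij)

lemma iUnion_slab : ⋃ n, slab d n = Set.univ := by
  refine Set.eq_univ_of_forall fun y => Set.mem_iUnion.mpr ?_
  obtain ⟨n, hn⟩ := exists_nat_ge |y.2.1|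
  exact ⟨n, mem_slab.mpr hn⟩

/-- The action of `m a_r` on `M × ℝ × S^{d-1}`. -/
def shiftMA (m : M d) (r : ℝ) (y : M d × ℝ × Bdry d) : M d × ℝ × Bdry d :=
  (m * y.1, r + y.2.1, y.2.2)

lemma measurable_shiftMA (m : M d) (r : ℝ) : Measurable (shiftMA m r) :=
  (measurable_fst.const_mul m).prodMk
    (((measurable_fst.comp measurable_snd).const_add r).prodMk
      (measurable_snd.comp measurable_snd))

lemma shiftMA_comp (m m' : M d) (r r' : ℝ) :
    shiftMA m r ∘ shiftMA m' r' = shiftMA (m * m') (r + r') := by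
  funext y
  simp [shiftMA, mul_assoc, add_assoc]

section Lift

variable {s : Bdry d → G d} (hs : IsBorelSection s) {μt : Measure (G d)}

lemma map_coord_symm_of_map_mul_left {q : G d} {c : ENNReal} (hq : μt.map (q * ·) = c • μt)
    {T : U d × M d × ℝ × Bdry d → U d × M d × ℝ × Bdry d} (hTm : Measurable T)
    (hT : ∀ p, coord s (T p) = q * coord s p) :
    (μt.map (coordEquiv s hs).symm).map T = c • μt.map (coordEquiv s hs).symm := by
  have e : T ∘ (coordEquiv s hs).symm = (coordEquiv s hs).symm ∘ (q * ·) := by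
    funext g
    have h1 : coord s ((coordEquiv s hs).symm g) = g := (coordEquiv s hs).apply_symm_apply g
    have h2 := hT ((coordEquiv s hs).symm g)
    rw [h1] at h2
    exact ((coordEquiv s hs).symm_apply_eq.mpr h2.symm).symm
  rw [Measure.map_map hTm (coordEquiv s hs).symm.measurable, e,
    ← Measure.map_map (coordEquiv s hs).symm.measurable (measurable_const_mul q), hq,
    Measure.map_smul]

open scoped Pointwise in
lemma map_coord_symm_lt_top [IsLocallyFiniteMeasure μt] {C : Set (U d)} (hC : IsCompact C)
    (n : ℕ) : μt.map (coordEquiv s hs).symm (C ×ˢ slab d n) < ⊤ := by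
  rw [MeasurableEquiv.map_apply]
  have hK : IsCompact ((Subtype.val '' C) * (M d : Set (G d)) *
      (a d '' Set.Icc (-n : ℝ) n) * (K d : Set (G d))) :=
    (((hC.image continuous_subtype_val).mul isCompact_M).mul
      (isCompact_Icc.image continuous_a)).mul isCompact_K
  refine lt_of_le_of_lt (measure_mono fun g hg => ?_) hK.measure_lt_top
  obtain ⟨h1, h2⟩ := hg
  have e : coord s ((coordEquiv s hs).symm g) = g := (coordEquiv s hs).apply_symm_apply g
  rw [← e]
  refine Set.mul_mem_mul (Set.mul_mem_mul (Set.mul_mem_mul ⟨_, h1, rfl⟩ (Subtype.property _))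
    ⟨_, ?_, rfl⟩) (hs.2 _).1
  exact h2.2.1

/-- The `U`-invariance of a measure on `G` splits off the Haar measure of `U`; the remaining factor
is multiplied by constants under the action of `MA`. -/
lemma exists_eq_prod_shiftMA [IsLocallyFiniteMeasure μt] (du : Measure (U d)) [du.IsHaarMeasure]
    (hU : ∀ u ∈ U d, μt.map (u * ·) = μt)
    (hMA : ∀ m ∈ M d, ∀ r, ∃ c : ENNReal, c ≠ 0 ∧ μt.map (m * a d r * ·) = c • μt) :
    ∃ ρ : Measure (M d × ℝ × Bdry d), (∀ n, ρ (slab d n) < ⊤) ∧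
      μt.map (coordEquiv s hs).symm = du.prod ρ ∧
      ∀ m r, ∃ c : ENNReal, c ≠ 0 ∧ ρ.map (shiftMA m r) = c • ρ := by
  obtain ⟨ρ, hρfin, hρ⟩ := exists_eq_prod_of_forall_map_mul_left du
    (μt.map (coordEquiv s hs).symm) measurableSet_slab monotone_slab iUnion_slab
    (fun C hC n => map_coord_symm_lt_top hs hC n) fun u => by
      have h := map_coord_symm_of_map_mul_left hs (μt := μt) (q := u) (c := 1)
        (by rw [hU u u.2, one_smul])
        (T := fun p => (u * p.1, p.2)) ((measurable_fst.const_mul u).prodMk measurable_snd)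
        fun p => by
          change (u * p.1 : G d) * p.2.1 * a d p.2.2.1 * s p.2.2.2 =
            u * (p.1 * p.2.1 * a d p.2.2.1 * s p.2.2.2)
          simp only [mul_assoc]
      rw [h, one_smul]
  refine ⟨ρ, hρfin, hρ, fun m r => ?_⟩
  have hσ : SigmaFinite ρ := ⟨⟨⟨slab d, fun _ => trivial, hρfin, iUnion_slab⟩⟩⟩
  obtain ⟨c, hc0, hc⟩ := hMA m m.2 r
  have hq := a_mul_comm_of_MA m.2 r
  obtain ⟨k, hk0, hkt, hk⟩ := exists_map_conjU du hq
  have hcm : Measurable (conjU hq) := (continuous_conjU hq).measurable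
  have h := map_coord_symm_of_map_mul_left hs hc
    (T := Prod.map (conjU hq) (shiftMA m r)) (hcm.prodMap (measurable_shiftMA m r)) fun p => by
      obtain ⟨u, m', t, ξ⟩ := p
      change (m * a d r * u * (m * a d r)⁻¹ : G d) * (m * m' : G d) * a d (r + t) * s ξ =
        m * a d r * (u * m' * a d t * s ξ)
      rw [a_add]
      have hcomm := (mem_M_iff.mp m'.2).2 r
      calc (m * a d r * u * (m * a d r)⁻¹ : G d) * (m * m' : G d) * (a d r * a d t) * s ξ
          = m * a d r * u * (a d r)⁻¹ * (m' * a d r) * a d t * s ξ := by group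
        _ = _ := by rw [← hcomm]; group
  rw [hρ, ← Measure.map_prod_map _ _ hcm (measurable_shiftMA m r), hk] at h
  obtain ⟨C, hC0, hCt⟩ := exists_measure_ne du
  refine ⟨k⁻¹ * c, mul_ne_zero (ENNReal.inv_ne_zero.mpr hkt) hc0, ?_⟩
  ext E _
  have h1 := congrArg (fun κ => κ (C ×ˢ E)) h
  simp only [Measure.smul_apply, Measure.prod_prod, smul_eq_mul] at h1
  rw [mul_assoc, mul_left_comm, mul_left_comm c, ENNReal.mul_right_inj hC0 hCt] at h1
  rw [Measure.smul_apply, smul_eq_mul, mul_assoc, ← h1, ← mul_assoc,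
    ENNReal.inv_mul_cancel hk0 hkt, one_mul]

end Lift

lemma shiftMA_preimage_slab_zero (m : M d) (n : ℕ) : shiftMA m 0 ⁻¹' slab d n = slab d n := by
  ext y
  simp [mem_slab, shiftMA]

lemma shiftMA_preimage_slab_subset (m : M d) {r : ℝ} (hr : |r| ≤ 1) (n : ℕ) :
    shiftMA m r ⁻¹' slab d n ⊆ slab d (n + 1) := by
  intro y hy
  rw [Set.mem_preimage, mem_slab] at hy
  rw [mem_slab]
  have h1 : |y.2.1| ≤ |r + y.2.1| + |r| := by
    have := abs_sub (r + y.2.1) r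
    rwa [add_sub_cancel_left] at this
  push_cast
  exact h1.trans (add_le_add hy hr)

/-- The multiplier under `MA` is trivial on `M` and exponential on `A`. -/
lemma exists_exponent {ρ : Measure (M d × ℝ × Bdry d)} (hfin : ∀ n, ρ (slab d n) < ⊤)
    (hρ : ρ ≠ 0) (hMA : ∀ m r, ∃ c : ENNReal, c ≠ 0 ∧ ρ.map (shiftMA m r) = c • ρ) :
    (∀ m, ρ.map (shiftMA m 0) = ρ) ∧
      ∃ β : ℝ, ∀ r, ρ.map (shiftMA 1 r) = expDens β (-r) • ρ := by
  obtain ⟨n, hn⟩ : ∃ n, ρ (slab d n) ≠ 0 := by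
    by_contra! h
    apply hρ
    rw [← Measure.measure_univ_eq_zero, ← iUnion_slab]
    exact measure_iUnion_null h
  have hnt := (hfin n).ne
  have cancel : ∀ x y : ENNReal, x * ρ (slab d n) = y * ρ (slab d n) → x = y := fun x y h =>
    (ENNReal.mul_left_inj hn hnt).mp h
  constructor
  · intro m
    obtain ⟨c, -, hc⟩ := hMA m 0
    have h1 := congrArg (fun κ => κ (slab d n)) hc
    simp only [Measure.smul_apply, smul_eq_mul] at h1
    rw [Measure.map_apply (measurable_shiftMA m 0) (measurableSet_slab n),
      shiftMA_preimage_slab_zero] at h1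
    rw [hc, ← cancel 1 c (by rw [one_mul]; exact h1), one_smul]
  · choose χ hχ0 hχ using fun r => hMA 1 r
    have hval : ∀ r, χ r * ρ (slab d n) = ρ (shiftMA 1 r ⁻¹' slab d n) := by
      intro r
      have h1 := congrArg (fun κ => κ (slab d n)) (hχ r)
      simp only [Measure.smul_apply, smul_eq_mul] at h1
      rw [Measure.map_apply (measurable_shiftMA 1 r) (measurableSet_slab n)] at h1
      exact h1.symm
    have hmul : ∀ r r', χ (r + r') = χ r * χ r' := by
      intro r r'
      refine cancel _ _ ?_
      have h1 : (ρ.map (shiftMA 1 r')).map (shiftMA 1 r) = (χ r * χ r') • ρ := by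
        rw [hχ r', Measure.map_smul, hχ r, smul_smul, mul_comm]
      rw [Measure.map_map (measurable_shiftMA _ _) (measurable_shiftMA _ _), shiftMA_comp, mul_one,
        hχ] at h1
      simpa using congrArg (fun κ => κ (slab d n)) h1
    have hbd : ∀ r, |r| ≤ 1 → χ r ≤ ρ (slab d (n + 1)) / ρ (slab d n) := by
      intro r hr
      rw [ENNReal.le_div_iff_mul_le (Or.inl hn) (Or.inl hnt), hval]
      exact measure_mono (shiftMA_preimage_slab_subset 1 hr n)
    have hBt : ρ (slab d (n + 1)) / ρ (slab d n) ≠ ⊤ := ENNReal.div_ne_top (hfin _).ne hn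
    have hsmall : ∀ r, |r| ≤ 1 → χ r ≠ ⊤ := fun r hr => ne_top_of_le_ne_top hBt (hbd r hr)
    have hχ1 : χ 0 = 1 := by
      have h1 := hmul 0 0
      rw [add_zero] at h1
      have h2 := (ENNReal.mul_right_inj (hχ0 0) (hsmall 0 (by simp)) (b := χ 0) (c := 1)).mp
      exact h2 (by rw [mul_one]; exact h1.symm)
    have hχt : ∀ r, χ r ≠ ⊤ := by
      intro r hr
      have h1 := hmul r (-r)
      rw [add_neg_cancel, hχ1, hr, ENNReal.top_mul (hχ0 _)] at h1
      exact ENNReal.one_ne_top h1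
    have hpos : ∀ r, 0 < (χ r).toReal := fun r => ENNReal.toReal_pos (hχ0 r) (hχt r)
    have hlog := eq_mul_of_additive_of_bddAbove (f := fun r => Real.log (χ r).toReal)
      (fun r r' => by
        rw [hmul, ENNReal.toReal_mul, Real.log_mul (hpos r).ne' (hpos r').ne'])
      (B := Real.log (ρ (slab d (n + 1)) / ρ (slab d n)).toReal)
      fun r hr => Real.log_le_log (hpos r) (ENNReal.toReal_mono hBt (hbd r hr))
    refine ⟨-Real.log (χ 1).toReal, fun r => ?_⟩
    rw [hχ r]
    congr 1
    rw [expDens, neg_mul_neg, ← hlog r, Real.exp_log (hpos r), ENNReal.ofReal_toReal (hχt r)]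

/-- A measure on `M × ℝ × S^{d-1}` which is `M`-invariant and is multiplied by `e^{-βr}` under
translation by `r` is the product `e^{βt} dν dm dt`. -/
lemma eq_prod_of_map_shiftMA (dm : Measure (M d)) [dm.IsHaarMeasure]
    {ρ : Measure (M d × ℝ × Bdry d)} (hfin : ∀ n, ρ (slab d n) < ⊤)
    (hM : ∀ m, ρ.map (shiftMA m 0) = ρ) {β : ℝ}
    (hA : ∀ r, ρ.map (shiftMA 1 r) = expDens β (-r) • ρ) :
    ∃ ν : Measure (Bdry d), IsFiniteMeasure ν ∧
      ρ = dm.prod ((volume.withDensity (expDens β)).prod ν) := by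
  let S : ℕ → Set (ℝ × Bdry d) := fun n => Set.Icc (-n : ℝ) n ×ˢ Set.univ
  have hSm : ∀ n, MeasurableSet (S n) := fun n => measurableSet_Icc.prod MeasurableSet.univ
  have hmono : Monotone S := fun i j hij => Set.prod_mono
    (Set.Icc_subset_Icc (neg_le_neg (Nat.cast_le.mpr hij)) (Nat.cast_le.mpr hij)) le_rfl
  have hS : ⋃ n, S n = Set.univ := by
    refine Set.eq_univ_of_forall fun y => Set.mem_iUnion.mpr ?_
    obtain ⟨n, hn⟩ := exists_nat_ge |y.1|
    exact ⟨n, abs_le.mp hn, trivial⟩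
  obtain ⟨κ, hκfin, hκ⟩ := exists_eq_prod_of_forall_map_mul_left dm ρ hSm hmono hS
    (fun C _ n => (measure_mono (Set.prod_mono (Set.subset_univ C) le_rfl)).trans_lt (hfin n))
    fun m => by
      have h : (fun p : M d × ℝ × Bdry d => (m * p.1, p.2)) = shiftMA m 0 := by
        funext p; simp [shiftMA]
      rw [h, hM m]
  have hσ : SigmaFinite κ := ⟨⟨⟨S, fun _ => trivial, hκfin, hS⟩⟩⟩
  have hTm : ∀ r : ℝ, Measurable fun y : ℝ × Bdry d => (r + y.1, y.2) := fun r =>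
    (measurable_fst.const_add r).prodMk measurable_snd
  have hκA : ∀ r : ℝ, κ.map (fun y => (r + y.1, y.2)) = expDens β (-r) • κ := by
    intro r
    obtain ⟨C, hC0, hCt⟩ := exists_measure_ne dm
    refine prod_left_cancel hC0 hCt ?_
    have h1 : shiftMA (1 : M d) r = Prod.map id fun y : ℝ × Bdry d => (r + y.1, y.2) := by
      funext y; simp [shiftMA, Prod.map]
    have h2 := hA r
    rw [hκ, h1, ← Measure.map_prod_map _ _ measurable_id (hTm r), Measure.map_id] at h2
    rw [h2, Measure.prod_smul_right]
  have hd : ∀ b : ℝ, Measurable fun y : ℝ × Bdry d => expDens b y.1 := fun b =>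
    (measurable_expDens b).comp measurable_fst
  set κ' := κ.withDensity fun y => expDens β (-y.1) with hκ'
  have hdn : Measurable fun y : ℝ × Bdry d => expDens β (-y.1) :=
    (measurable_expDens β).comp measurable_fst.neg
  have hinv : ∀ r : ℝ, κ'.map (fun y => (r + y.1, y.2)) = κ' := by
    intro r
    refine Measure.ext_of_lintegral _ fun f hf => ?_
    have hfr : Measurable fun y : ℝ × Bdry d => f (r + y.1, y.2) := hf.comp (hTm r)
    obtain ⟨w, hw⟩ : ∃ w : ℝ × Bdry d → ENNReal, w = fun z => expDens β (-z.1) * f z := ⟨_, rfl⟩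
    have hwm : Measurable w := hw ▸ hdn.mul hf
    have hwr : Measurable fun y : ℝ × Bdry d => w (r + y.1, y.2) := hwm.comp (hTm r)
    have e : ∀ y : ℝ × Bdry d, ((fun y : ℝ × Bdry d => expDens β (-y.1)) *
        fun y : ℝ × Bdry d => f (r + y.1, y.2)) y = expDens β r * w (r + y.1, y.2) := by
      intro y
      simp only [Pi.mul_apply, hw]
      rw [← mul_assoc, ← expDens_add]
      congr 2
      ring
    rw [lintegral_map hf (hTm r), lintegral_withDensity_eq_lintegral_mul _ hdn hfr,
      lintegral_congr e, lintegral_const_mul _ hwr, ← lintegral_map hwm (hTm r), hκA,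
      lintegral_smul_measure, smul_eq_mul, ← mul_assoc, ← expDens_add, add_neg_cancel,
      expDens_zero, one_mul, lintegral_withDensity_eq_lintegral_mul _ hdn hf, hw]
    rfl
  obtain ⟨ν, hνfin, hν⟩ := exists_eq_prod_of_forall_map_add_left (volume : Measure ℝ) κ'
    (S := fun _ => (Set.univ : Set (Bdry d))) (fun _ => MeasurableSet.univ) monotone_const
    (Set.iUnion_const _) (fun C hC _ => by
      obtain ⟨N, hN⟩ := hC.isBounded.exists_norm_le
      obtain ⟨n, hn⟩ := exists_nat_ge N
      have hsub : C ×ˢ Set.univ ⊆ S n := fun y hy => ⟨abs_le.mp ((hN _ hy.1).trans hn), trivial⟩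
      refine (measure_mono hsub).trans_lt ?_
      rw [hκ', withDensity_apply _ (hSm n)]
      refine (setLIntegral_mono (g := fun _ => ENNReal.ofReal (Real.exp (|β| * n)))
        measurable_const fun y hy => ?_).trans_lt ?_
      · refine ENNReal.ofReal_le_ofReal (Real.exp_le_exp.mpr ?_)
        refine (le_abs_self _).trans ?_
        rw [abs_mul, abs_neg]
        exact mul_le_mul_of_nonneg_left (abs_le.mpr hy.1) (abs_nonneg _)
      · rw [setLIntegral_const]
        exact ENNReal.mul_lt_top ENNReal.ofReal_lt_top (hκfin n)) hinv
  refine ⟨ν, ⟨hνfin 0⟩, ?_⟩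
  have hν' : IsFiniteMeasure ν := ⟨hνfin 0⟩
  rw [hκ, prod_withDensity_left (measurable_expDens β), ← hν, hκ', ← withDensity_mul _ hdn (hd β)]
  have h1 : ((fun y : ℝ × Bdry d => expDens β (-y.1)) * fun y => expDens β y.1) = 1 := by
    funext y
    rw [Pi.mul_apply, ← expDens_add, neg_add_cancel, expDens_zero]
    rfl
  rw [h1, withDensity_one]

end HoroMeasure

end

theorem mainTheorem6 (d : ℕ) (hd : 2 ≤ d)
    (Γ : Subgroup (HoroMeasure.G d)) [DiscreteTopology Γ]
    (du : Measure (HoroMeasure.U d)) [du.IsHaarMeasure]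
    (dm : Measure (HoroMeasure.M d)) [dm.IsHaarMeasure]
    (μ : Measure (HoroMeasure.G d ⧸ Γ)) [IsLocallyFiniteMeasure μ]
    [ErgodicSMul (HoroMeasure.U d) (HoroMeasure.G d ⧸ Γ) μ]
    (hMA : HoroMeasure.IsQuasiInvariantMA μ) :
    (∃ s : HoroMeasure.Bdry d → HoroMeasure.G d, HoroMeasure.IsBorelSection s) ∧
    ∃ (μt : Measure (HoroMeasure.G d)) (β : ℝ) (ν : Measure (HoroMeasure.Bdry d)),
      HoroMeasure.IsLift μ μt ∧ IsFiniteMeasure ν ∧ HoroMeasure.IsConformal Γ β ν ∧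
      ∀ s : HoroMeasure.Bdry d → HoroMeasure.G d, HoroMeasure.IsBorelSection s →
        μt = (HoroMeasure.coordMeasure du dm β ν).map (HoroMeasure.coord s) := by
  open HoroMeasure in
  refine ⟨exists_isBorelSection, ?_⟩
  obtain ⟨s, hs⟩ := exists_isBorelSection (d := d)
  obtain ⟨μt, hμt⟩ := exists_isLift μ
  suffices h : ∃ (β : ℝ) (ν : Measure (Bdry d)), IsFiniteMeasure ν ∧
      μt = (coordMeasure du dm β ν).map (coord s) by
    obtain ⟨β, ν, hν, h⟩ := h
    refine ⟨μt, β, ν, hμt, hν, ?_, fun s' hs' => ?_⟩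
    · refine isConformal_of_map_mul_right du dm hs fun γ hγ => ?_
      rw [← h]
      exact hμt.map_mul_right hγ
    · rw [h, map_coord_eq_of_isBorelSection du dm β ν hs hs']
  rcases eq_or_ne μ 0 with rfl | hμ
  · refine ⟨0, 0, inferInstance, ?_⟩
    have h0 : μt = 0 := by
      rw [← Measure.measure_univ_eq_zero, ← lintegral_one, hμt.lintegral_eq measurable_const,
        lintegral_zero_measure]
    rw [h0, coordMeasure, Measure.prod_zero, Measure.prod_zero, Measure.prod_zero,
      Measure.map_zero]
  have hlf := hμt.isLocallyFiniteMeasure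
  have hU : ∀ u ∈ U d, μt.map (u * ·) = μt := by
    intro u hu
    have h1 : μ.map (fun x => u • x) = (1 : ENNReal) • μ := by
      rw [one_smul]
      have h2 : (fun x : G d ⧸ Γ => u • x) = fun x => (⟨u, hu⟩ : U d) • x :=
        funext fun x => (U_smul_eq ⟨u, hu⟩ x).symm
      rw [h2]
      exact (measurePreserving_smul (⟨u, hu⟩ : U d) μ).map_eq
    rw [hμt.map_mul_left h1, one_smul]
  obtain ⟨ρ, hfin, hρ, hshift⟩ := exists_eq_prod_shiftMA hs du hU fun m hm r => by
    obtain ⟨c, hc0, hc⟩ := exists_map_smul_eq_smul hμ hMA hm r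
    exact ⟨c, hc0, hμt.map_mul_left hc⟩
  have hback : μt = (du.prod ρ).map (coord s) := by
    rw [← hρ]
    exact (coordEquiv s hs).map_map_symm.symm
  have hρ0 : ρ ≠ 0 := by
    rintro rfl
    apply hμt.ne_zero hμ
    rw [hback, Measure.prod_zero, Measure.map_zero]
  obtain ⟨hM, β, hA⟩ := exists_exponent hfin hρ0 hshift
  obtain ⟨ν, hν, h⟩ := eq_prod_of_map_shiftMA dm hfin hM hA
  exact ⟨β, ν, hν, by rw [hback, h]; rfl⟩
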